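/- All digraphs may be infinite. For an undirected graph $G$, let $\mathcal D(G)$ be the digraph obtained by replacing each edge $uv$ by the two directed edges $(u,v)$ and $(v,u)$; a *double path* is $\mathcal D(P)$ for a finite (possibly trivial) path $P$. A *dominated directed ray* consists of a ray oriented away from its first vertex $r$ together with the edges $(v,r)$ for all vertices $v\neq r$ of the ray, or is obtained from such a digraph by reversing all edges. A *comb* $C$ is the union of a one-way infinite ray $R$ and infinitely many disjoint finite (possibly trivial) paths having exactly their first vertex on $R$; its *teeth* are the last vertices of these paths, and its *junctions* are the vertices of degree $3$ and the teeth of degree $2$. Consider the following six types of digraphs $D$ with a set of *teeth*. 1. $D=\mathcal D(S)$ for a subdivided infinite star $S$; the teeth are the leaves of $S$. 2. $D$ is obtained from $\mathcal D(S)$, for a subdivided infinite star $S$ with centre $w$, by replacing $w$ by a dominated directed ray with vertex set $\{w_n : n\in N_S(w)\}$ (the $w_n$ being distinct), the edges $(w,n),(n,w)$ becoming incident with $w_n$ instead of $w$; the teeth are the leaves of $S$. 3. $D$ is a dominated directed ray; all its vertices are teeth. 4. $D=\mathcal D(C)$ for a comb $C$; the teeth are those of $C$. 5. $D$ is obtained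 from $\mathcal D(C)$, for a comb $C$, by replacing each junction $j$ by a directed cycle of length $3$ (of either orientation) such that, if $j$ has degree $3$ in $C$, the three strong components of $\mathcal D(C)-j$ become incident with distinct vertices of the cycle, and otherwise the tooth $j$ is a vertex of the cycle and the two strong components of $\mathcal D(C)-j$ become incident with the two other vertices, respectively; the teeth are those of $C$. 6. $D$ is a chain of triangles: it has distinct vertices $a_i,b_i,c_i$ and edges $(a_i,b_i),(b_i,c_i),(c_i,a_i),(a_{i+1},a_i),(c_i,c_{i+1})$ for $i\in\mathbb N$, together with disjoint (possibly trivial) double paths, one from each $b_i$ to a vertex $y_i$, meeting $\bigcup_i\{a_i,b_i,c_i\}$ only in $b_i$; the teeth are the $y_i$. A digraph $H$ is a *butterfly minor* of a digraph $D$ if it has a tree-like model $\mu$ in $D$: disjoint subgraphs $\mu(v)$ of $D$ for $v\in V(H)$, each the union of an in-arborescence $T^{\mathrm{in}}_v$ and an out-arborescence $T^{\mathrm{out}}_v$ having exactly their common root in common, and for every edge $e=(u,v)$ of $H$ an edge $\mu(e)$ of $D$ with tail in $T^{\mathrm{out}}_u$ and head in $T^{\mathrm{in}}_v$. Each vertex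 $v$ of $H$ is identified with the root of $T^{\mathrm{in}}_v$ and $T^{\mathrm{out}}_v$. **Proposition.** Let $D$ be a digraph of one of these six types, and let $D'$ be a strongly connected butterfly minor of $D$ that contains infinitely many teeth of $D$. Then $D'$ is not of a different type than $D$. Consequently each of the six types is necessary: for each of the six types there exist a strongly connected digraph $D$ of this type and an infinite set $U\subseteq V(D)$ (the set of teeth of $D$) such that every butterfly minor of $D$ that is of one of the six types and has all its teeth in $U$ is of this very type. -/

import Mathlib

/-! Directed graphs are `Digraph V`. Every digraph that has one of the six types below has neither
loops nor parallel edges. -/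

universe u v

namespace DirectedStarComb

/-- Every vertex can be reached from every vertex along directed edges. -/
def StronglyConnected {V : Type u} (D : Digraph V) : Prop :=
  ∀ x y : V, Relation.ReflTransGen D.Adj x y

/-- A (not necessarily induced) subgraph of a digraph. -/
structure Subdigraph {V : Type u} (D : Digraph V) where
  verts : Set V
  Adj : V → V → Prop
  adj_sub : ∀ {x y}, Adj x y → D.Adj x y
  fst_mem : ∀ {x y}, Adj x y → x ∈ verts
  snd_mem : ∀ {x y}, Adj x y → y ∈ verts

/-- An out-arborescence with root `r`, i.e. a rooted tree with all edges directed away from the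
root: nothing enters the root, every vertex has at most one incoming edge,
and every vertex can be reached from the root. -/
structure IsOutArborescence {V : Type u} {D : Digraph V} (T : Subdigraph D) (r : V) : Prop where
  root_mem : r ∈ T.verts
  not_adj_root : ∀ x, ¬ T.Adj x r
  unique_in : ∀ {x y z}, T.Adj x z → T.Adj y z → x = y
  reachable : ∀ x ∈ T.verts, Relation.ReflTransGen T.Adj r x

/-- An in-arborescence with root `r`, i.e. a rooted tree with all edges directed towards the root:
nothing leaves the root, every vertex has at most one outgoing edge,
and every vertex can reach the root. -/
structure IsInArborescence {V : Type u} {D : Digraph V} (T : Subdigraph D) (r : V) : Prop where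
  root_mem : r ∈ T.verts
  not_root_adj : ∀ x, ¬ T.Adj r x
  unique_out : ∀ {x y z}, T.Adj z x → T.Adj z y → x = y
  reachable : ∀ x ∈ T.verts, Relation.ReflTransGen T.Adj x r

/-- A tree-like model of `H` in `D`: the branch set of `w` is the union of the in-arborescence
`inTree w` and the out-arborescence `outTree w`, which share only their common root `root w`;
distinct branch sets are disjoint; every edge `(w, z)` of `H` is mapped to an edge of `D` with tail
in `outTree w` and head in `inTree z`.
The vertex `w` of the butterfly minor `H` is identified with the vertex `root w` of `D`. -/
structure TreeLikeModel {W : Type v} {V : Type u} (H : Digraph W) (D : Digraph V) where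
  root : W → V
  inTree : W → Subdigraph D
  outTree : W → Subdigraph D
  isIn : ∀ w, IsInArborescence (inTree w) (root w)
  isOut : ∀ w, IsOutArborescence (outTree w) (root w)
  inter : ∀ w, (inTree w).verts ∩ (outTree w).verts = {root w}
  disjoint : ∀ w z, w ≠ z →
    Disjoint ((inTree w).verts ∪ (outTree w).verts) ((inTree z).verts ∪ (outTree z).verts)
  edgeTail : ∀ {w z}, H.Adj w z → V
  edgeHead : ∀ {w z}, H.Adj w z → V
  edge_adj : ∀ {w z} (e : H.Adj w z), D.Adj (edgeTail e) (edgeHead e)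
  edgeTail_mem : ∀ {w z} (e : H.Adj w z), edgeTail e ∈ (outTree w).verts
  edgeHead_mem : ∀ {w z} (e : H.Adj w z), edgeHead e ∈ (inTree z).verts

/-! ### Attaching double paths -/

/-- The edges of the digraph obtained from `K` by attaching disjoint double paths: for each `i`, the
double path `β i, (i, 0), (i, 1), …, (i, len i - 1)` with `len i` new vertices. -/
inductive AttachAdj {B I : Type u} (K : Digraph B) (β : I → B) (len : I → ℕ) :
    B ⊕ (Σ i : I, Fin (len i)) → B ⊕ (Σ i : I, Fin (len i)) → Prop
  | core {x y : B} (h : K.Adj x y) : AttachAdj K β len (Sum.inl x) (Sum.inl y)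
  | firstOut (i : I) (h : 0 < len i) :
      AttachAdj K β len (Sum.inl (β i)) (Sum.inr ⟨i, ⟨0, h⟩⟩)
  | firstIn (i : I) (h : 0 < len i) :
      AttachAdj K β len (Sum.inr ⟨i, ⟨0, h⟩⟩) (Sum.inl (β i))
  | stepOut (i : I) (k : ℕ) (h : k + 1 < len i) :
      AttachAdj K β len (Sum.inr ⟨i, ⟨k, by omega⟩⟩) (Sum.inr ⟨i, ⟨k + 1, h⟩⟩)
  | stepIn (i : I) (k : ℕ) (h : k + 1 < len i) :
      AttachAdj K β len (Sum.inr ⟨i, ⟨k + 1, h⟩⟩) (Sum.inr ⟨i, ⟨k, by omega⟩⟩)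

/-- The digraph obtained from `K` by attaching to `β i`, for each `i`, a double path with `len i`
edges; these double paths meet `K` only in `β i`. -/
def attach {B I : Type u} (K : Digraph B) (β : I → B) (len : I → ℕ) :
    Digraph (B ⊕ (Σ i : I, Fin (len i))) where
  Adj := AttachAdj K β len

/-- The last vertex of the `i`-th attached double path (which is `β i` if that path is trivial). -/
def lastVertex {B I : Type u} (β : I → B) (len : I → ℕ) (i : I) :
    B ⊕ (Σ i : I, Fin (len i)) :=
  if h : 0 < len i then Sum.inr ⟨i, ⟨len i - 1, by omega⟩⟩ else Sum.inl (β i)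

/-! ### The cores -/

/-- The digraph with one vertex and no edge. -/
def single : Digraph PUnit.{u + 1} where
  Adj _ _ := False

/-- The dominated directed ray with root `0` on an out-ray: the edges `(n, n + 1)`, and `(n, 0)` for
`n ≠ 0`. -/
def dominatedOutRay : Digraph ℕ where
  Adj m n := n = m + 1 ∨ (m ≠ 0 ∧ n = 0)

/-- The dominated directed ray with root `0` on an in-ray: all edges of `dominatedOutRay`
reversed. -/
def dominatedInRay : Digraph ℕ where
  Adj m n := dominatedOutRay.Adj n m

/-- `𝒟(R)` for the undirected ray `R = 0 1 2 …`. -/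
def doubleRay : Digraph ℕ where
  Adj m n := n = m + 1 ∨ m = n + 1

/-- For a comb with back `0 1 2 …`, where exactly the vertices in `J` are the first vertices
of its (possibly trivial) paths to the teeth, the junctions are the elements of `J` other than the
root `0` of the ray. Each junction `n` is replaced by the three vertices `(n, 0)`, `(n, 1)`,
`(n, 2)`; the vertex `(n, 0)` represents any other `n`. -/
abbrev TriangleCombVertex (J : Set ℕ) : Type :=
  {x : ℕ × Fin 3 // x.2 = 0 ∨ (x.1 ∈ J ∧ x.1 ≠ 0)}

/-- The right end of the part replacing `n` : its vertex that is joined to the part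
replacing `n + 1`. -/
def rightEnd (J : Set ℕ) [DecidablePred (· ∈ J)] (n : ℕ) : TriangleCombVertex J :=
  if h : n ∈ J ∧ n ≠ 0 then ⟨(n, 1), Or.inr h⟩ else ⟨(n, 0), Or.inl rfl⟩

/-- The left end of the part replacing `n`: its vertex that is joined to the part replacing
`n - 1` if `n ≠ 0`. -/
def leftEnd (J : Set ℕ) (n : ℕ) : TriangleCombVertex J :=
  ⟨(n, 0), Or.inl rfl⟩

/-- The vertex of the part replacing `n` at which the path to the tooth is attached (and which
is the tooth itself if that path is trivial). -/
def toothEnd (J : Set ℕ) [DecidablePred (· ∈ J)] (n : ℕ) : TriangleCombVertex J :=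
  if h : n ∈ J ∧ n ≠ 0 then ⟨(n, 2), Or.inr h⟩ else ⟨(n, 0), Or.inl rfl⟩

/-- `𝒟(R)` for the undirected ray `R = 0 1 2 …` with each `n ∈ J`, `n ≠ 0`, replaced by a directed
cycle of length three, which is oriented according to `o n`. -/
inductive TriangleRayAdj (J : Set ℕ) [DecidablePred (· ∈ J)] (o : ℕ → Bool) :
    TriangleCombVertex J → TriangleCombVertex J → Prop
  | cycle (n : ℕ) (h : n ∈ J ∧ n ≠ 0) (k : Fin 3) (ho : o n = true) :
      TriangleRayAdj J o ⟨(n, k), Or.inr h⟩ ⟨(n, k + 1), Or.inr h⟩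
  | cycleRev (n : ℕ) (h : n ∈ J ∧ n ≠ 0) (k : Fin 3) (ho : o n = false) :
      TriangleRayAdj J o ⟨(n, k + 1), Or.inr h⟩ ⟨(n, k), Or.inr h⟩
  | toRight (n : ℕ) : TriangleRayAdj J o (rightEnd J n) (leftEnd J (n + 1))
  | toLeft (n : ℕ) : TriangleRayAdj J o (leftEnd J (n + 1)) (rightEnd J n)

/-- The digraph with the edges `TriangleRayAdj`. -/
def triangleRay (J : Set ℕ) [DecidablePred (· ∈ J)] (o : ℕ → Bool) :
    Digraph (TriangleCombVertex J) where
  Adj := TriangleRayAdj J o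

/-- The edges of the core of a chain of triangles; here `a i = (i, 0)`, `b i = (i, 1)`,
`c i = (i, 2)`. -/
inductive TriangleChainAdj : ℕ × Fin 3 → ℕ × Fin 3 → Prop
  | ab (i : ℕ) : TriangleChainAdj (i, 0) (i, 1)
  | bc (i : ℕ) : TriangleChainAdj (i, 1) (i, 2)
  | ca (i : ℕ) : TriangleChainAdj (i, 2) (i, 0)
  | aa (i : ℕ) : TriangleChainAdj (i + 1, 0) (i, 0)
  | cc (i : ℕ) : TriangleChainAdj (i, 2) (i + 1, 2)

/-- The core of a chain of triangles. -/
def triangleChain : Digraph (ℕ × Fin 3) where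
  Adj := TriangleChainAdj

/-! ### The six types -/

/-- `D` is isomorphic to `K` by an isomorphism that maps `S` onto `T`. -/
def IsCopy {V : Type u} {B : Type v} (D : Digraph V) (T : Set V) (K : Digraph B) (S : Set B) :
    Prop :=
  ∃ φ : K.Adj ≃r D.Adj, T = φ '' S

/-- `D = 𝒟(S)` for a subdivided infinite star `S` with set of leaves `T`. -/
def IsVertexStar {V : Type u} (D : Digraph V) (T : Set V) : Prop :=
  ∃ (I : Type u) (len : I → ℕ), Infinite I ∧ (∀ i, 0 < len i) ∧
    IsCopy D T (attach single.{u} (fun _ : I => PUnit.unit) len)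
      (Set.range (lastVertex (fun _ : I => PUnit.unit) len))

/-- `D` arises from `𝒟(S)`, for a subdivided infinite star `S`, by replacing the centre by a
dominated directed ray each of whose vertices is incident with exactly one of the double paths
arising from `S`; the teeth are the leaves of `S`. -/
def IsRayStar {V : Type u} (D : Digraph V) (T : Set V) : Prop :=
  ∃ K : Digraph ℕ, (K = dominatedOutRay ∨ K = dominatedInRay) ∧
    ∃ len : ℕ → ℕ, (∀ n, 0 < len n) ∧
      IsCopy D T (attach K id len) (Set.range (lastVertex (id : ℕ → ℕ) len))

/-- `D` is a dominated directed ray; all its vertices are teeth. -/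
def IsDominatedRay {V : Type u} (D : Digraph V) (T : Set V) : Prop :=
  IsCopy D T dominatedOutRay Set.univ ∨ IsCopy D T dominatedInRay Set.univ

/-- `D = 𝒟(C)` for a comb `C` with set of teeth `T`; here `J` is the set of those vertices of the
ray `0 1 2 …` in which the disjoint, possibly trivial, paths to the teeth start. -/
def IsComb {V : Type u} (D : Digraph V) (T : Set V) : Prop :=
  ∃ (J : Set ℕ) (len : J → ℕ), J.Infinite ∧
    IsCopy D T (attach doubleRay (fun j : J => (j : ℕ)) len)
      (Set.range (lastVertex (fun j : J => (j : ℕ)) len))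

open scoped Classical in
/-- `D` arises from `𝒟(C)`, for a comb `C`, by replacing each junction by a directed cycle of length
three. -/
def IsTriangleComb {V : Type u} (D : Digraph V) (T : Set V) : Prop :=
  ∃ (J : Set ℕ) (len : J → ℕ) (o : ℕ → Bool), J.Infinite ∧
    IsCopy D T (attach (triangleRay J o) (fun j : J => toothEnd J j) len)
      (Set.range (lastVertex (fun j : J => toothEnd J j) len))

/-- `D` is a chain of triangles with set of teeth `T`. -/
def IsTriangleChain {V : Type u} (D : Digraph V) (T : Set V) : Prop :=
  ∃ len : ℕ → ℕ,
    IsCopy D T (attach triangleChain (fun i : ℕ => (i, (1 : Fin 3))) len)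
      (Set.range (lastVertex (fun i : ℕ => (i, (1 : Fin 3))) len))

/-- The six types of directed graphs. -/
inductive OutcomeType
  | vertexStar
  | rayStar
  | dominatedRay
  | comb
  | triangleComb
  | triangleChain

/-- `D` is of type `t`, with `T` as its set of teeth. -/
def HasType {V : Type u} : OutcomeType → Digraph V → Set V → Prop
  | .vertexStar, D, T => IsVertexStar D T
  | .rayStar, D, T => IsRayStar D T
  | .dominatedRay, D, T => IsDominatedRay D T
  | .comb, D, T => IsComb D T
  | .triangleComb, D, T => IsTriangleComb D T
  | .triangleChain, D, T => IsTriangleChain D T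

end DirectedStarComb

namespace DirectedStarComb

/-! Each type is distinguished by a few connectivity properties (its `Profile`), and each host of a
given type has minors that lack part of every other profile. The profiles are checked on the
standard copies, and models are transported along isomorphisms, so that only standard copies are
compared (`eq_of_profile`).

The main tool is the form of a branch set. A walk of the minor ending at `w` lifts to a walk of the
host that uses only the in-arborescence of `w`, and a walk starting at `w` lifts to one that uses
only its out-arborescence. Hence a vertex of the host that is unavoidable in both directions can lie
in the branch set of `w` only as its root.

The exclusions by host are as follows. In a star, removing the centre leaves finite pieces, so a
minor has no ray that is eventually connected around every vertex. In a ray star or dominated ray,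
every backward walk passes through the root of the ray, which rules out strong rays; moreover no
vertex of a minor has both infinite in-degree and infinite out-degree. A tooth on a pendant path is
cut off by one vertex, so a ray star does not contain a dominated ray with such a tooth, whereas two
disjoint digons cannot both use the root, so a dominated ray does not contain a ray star.

Combs and triangle combs are exhausted by finite sets with one boundary vertex, which forces any two
infinite connected subgraphs to meet; this excludes the stars and dominated rays. Combs have only
bridges, hence no minor with a directed triangle. A triangle comb is split into three parts by each
of its triangles, and three teeth make such a trisection survive in the minor; combs and chains of
triangles have none. Conversely, in a chain of triangles, walks to the right run along the `c i` and
walks to the left along the `a i`. The root of a cut vertex of the minor would have to lie on both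
rows; the same picture bounds all degrees. -/

open Relation

/-! ### Reachability inside a set of vertices -/

theorem reflTransGen_map {V : Type u} {V' : Type v} {R : V → V → Prop} {R' : V' → V' → Prop}
    (f : V → V') (hf : ∀ a b, R a b → R' (f a) (f b)) {x y : V} (h : ReflTransGen R x y) :
    ReflTransGen R' (f x) (f y) := by
  induction h with
  | refl => exact .refl
  | tail _ h ih => exact ih.tail (hf _ _ h)

theorem reflTransGen_swap {V : Type u} {R : V → V → Prop} {x y : V} (h : ReflTransGen R x y) :
    ReflTransGen (fun a b => R b a) y x := by
  induction h with
  | refl => exact .refl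
  | tail _ h ih => exact ih.head h

/-- `y` can be reached from `x` along `R`-edges with both ends in `A`. -/
def ReachIn {V : Type u} (R : V → V → Prop) (A : Set V) : V → V → Prop :=
  ReflTransGen fun p q => R p q ∧ p ∈ A ∧ q ∈ A

/-- Adjacency in the underlying undirected graph. -/
def WeakAdj {V : Type u} (D : Digraph V) (x y : V) : Prop := D.Adj x y ∨ D.Adj y x

/-- The digraph obtained by reversing all edges. -/
def rev {V : Type u} (D : Digraph V) : Digraph V where
  Adj x y := D.Adj y x

section ReachIn

variable {V : Type u} {R R' : V → V → Prop} {A B : Set V} {x y z : V}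

theorem WeakAdj.symm {D : Digraph V} (h : WeakAdj D x y) : WeakAdj D y x := Or.symm h

theorem ReachIn.refl (R : V → V → Prop) (A : Set V) (x : V) : ReachIn R A x x := ReflTransGen.refl

theorem ReachIn.single (h : R x y) (hx : x ∈ A) (hy : y ∈ A) : ReachIn R A x y :=
  ReflTransGen.single ⟨h, hx, hy⟩

theorem ReachIn.trans (h : ReachIn R A x y) (h' : ReachIn R A y z) : ReachIn R A x z :=
  ReflTransGen.trans h h'

theorem ReachIn.mono (h : ReachIn R A x y) (hR : ∀ p q, R p q → R' p q) (hA : A ⊆ B) :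
    ReachIn R' B x y :=
  reflTransGen_map id (fun p q ⟨h₁, h₂, h₃⟩ => ⟨hR p q h₁, hA h₂, hA h₃⟩) h

theorem ReachIn.subset (h : ReachIn R A x y) (hA : A ⊆ B) : ReachIn R B x y :=
  h.mono (fun _ _ => id) hA

theorem ReachIn.swap (h : ReachIn R A x y) : ReachIn (fun p q => R q p) A y x := by
  induction h with
  | refl => exact .refl _ _ _
  | tail _ h ih => exact (ReachIn.single (R := fun p q => R q p) h.1 h.2.2 h.2.1).trans ih

theorem ReachIn.weak {D : Digraph V} (h : ReachIn D.Adj A x y) : ReachIn (WeakAdj D) A x y :=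
  h.mono (fun _ _ => Or.inl) subset_rfl

theorem ReachIn.weak_symm {D : Digraph V} (h : ReachIn (WeakAdj D) A x y) :
    ReachIn (WeakAdj D) A y x :=
  h.swap.mono (fun _ _ h => h.symm) subset_rfl

theorem reachIn_univ (h : ReflTransGen R x y) : ReachIn R Set.univ x y :=
  reflTransGen_map id (fun _ _ h => ⟨h, trivial, trivial⟩) h

/-- All separation arguments below rest on this: the edge at which a walk leaves `S` is found
together with the information that its ends lie in `A`. -/
theorem ReachIn.crossing (h : ReachIn R A x y) {S : Set V} (hx : x ∈ S) (hy : y ∉ S) :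
    ∃ p ∈ S, ∃ q ∉ S, p ∈ A ∧ q ∈ A ∧ R p q := by
  induction h with
  | refl => exact absurd hx hy
  | @tail b c _ h ih =>
    by_cases hb : b ∈ S
    · exact ⟨b, hb, c, hy, h.2.1, h.2.2, h.1⟩
    · exact ih hb

theorem stronglyConnected_rev {D : Digraph V} (h : StronglyConnected D) :
    StronglyConnected (rev D) := fun x y =>
  reflTransGen_swap (h y x)

end ReachIn

/-! ### Tree-like models -/

namespace TreeLikeModel

variable {W : Type v} {V : Type u} {H : Digraph W} {D : Digraph V} (μ : TreeLikeModel H D)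

/-- The branch set of `w`. -/
def branch (w : W) : Set V := (μ.inTree w).verts ∪ (μ.outTree w).verts

theorem root_mem_in (w : W) : μ.root w ∈ (μ.inTree w).verts := (μ.isIn w).root_mem

theorem root_mem (w : W) : μ.root w ∈ μ.branch w := Or.inl (μ.root_mem_in w)

theorem in_subset (w : W) : (μ.inTree w).verts ⊆ μ.branch w := Set.subset_union_left

theorem out_subset (w : W) : (μ.outTree w).verts ⊆ μ.branch w := Set.subset_union_right

theorem eq_of_mem_branch {w z : W} {x : V} (h : x ∈ μ.branch w) (h' : x ∈ μ.branch z) : w = z := by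
  by_contra hne
  exact Set.disjoint_left.1 (μ.disjoint w z hne) h h'

theorem eq_root {w : W} {x : V} (h : x ∈ (μ.inTree w).verts) (h' : x ∈ (μ.outTree w).verts) :
    x = μ.root w := by
  have : x ∈ (μ.inTree w).verts ∩ (μ.outTree w).verts := ⟨h, h'⟩
  rwa [μ.inter w] at this

theorem root_injective : Function.Injective μ.root := fun w z h =>
  μ.eq_of_mem_branch (μ.root_mem w) (h ▸ μ.root_mem z)

theorem reachIn_in {w : W} {x : V} (h : x ∈ (μ.inTree w).verts) :
    ReachIn D.Adj (μ.inTree w).verts x (μ.root w) :=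
  reflTransGen_map id (fun _ _ h => ⟨(μ.inTree w).adj_sub h, (μ.inTree w).fst_mem h,
    (μ.inTree w).snd_mem h⟩) ((μ.isIn w).reachable x h)

theorem reachIn_out {w : W} {x : V} (h : x ∈ (μ.outTree w).verts) :
    ReachIn D.Adj (μ.outTree w).verts (μ.root w) x :=
  reflTransGen_map id (fun _ _ h => ⟨(μ.outTree w).adj_sub h, (μ.outTree w).fst_mem h,
    (μ.outTree w).snd_mem h⟩) ((μ.isOut w).reachable x h)

theorem reachIn_weak_root {w : W} {x : V} (h : x ∈ μ.branch w) :
    ReachIn (WeakAdj D) (μ.branch w) x (μ.root w) := by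
  rcases h with h | h
  · exact (μ.reachIn_in h).weak.subset (μ.in_subset w)
  · exact (μ.reachIn_out h).weak.weak_symm.subset (μ.out_subset w)

theorem branch_crossing {w : W} {x y : V} (hx : x ∈ μ.branch w) (hy : y ∈ μ.branch w) {S : Set V}
    (hxS : x ∈ S) (hyS : y ∉ S) :
    ∃ p ∈ S, ∃ q ∉ S, p ∈ μ.branch w ∧ q ∈ μ.branch w ∧ WeakAdj D p q :=
  ((μ.reachIn_weak_root hx).trans (μ.reachIn_weak_root hy).weak_symm).crossing hxS hyS

theorem reachIn_step {w z : W} (h : H.Adj w z) :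
    ReachIn D.Adj ((μ.outTree w).verts ∪ (μ.inTree z).verts) (μ.root w) (μ.root z) :=
  (((μ.reachIn_out (μ.edgeTail_mem h)).subset Set.subset_union_left).trans
    (ReachIn.single (μ.edge_adj h) (Or.inl (μ.edgeTail_mem h)) (Or.inr (μ.edgeHead_mem h)))).trans
    ((μ.reachIn_in (μ.edgeHead_mem h)).subset Set.subset_union_right)

/-- The union of the branch sets of the elements of `Z`. -/
def cover (Z : Set W) : Set V := ⋃ z ∈ Z, μ.branch z

theorem mem_cover {Z : Set W} {x : V} : x ∈ μ.cover Z ↔ ∃ z ∈ Z, x ∈ μ.branch z := by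
  simp [cover]

theorem branch_subset_cover {Z : Set W} {z : W} (h : z ∈ Z) : μ.branch z ⊆ μ.cover Z :=
  fun _ hx => μ.mem_cover.2 ⟨z, h, hx⟩

theorem reachIn_cover_step {Z : Set W} {w z : W} (h : H.Adj w z) (hw : w ∈ Z) (hz : z ∈ Z) :
    ReachIn D.Adj (μ.cover Z) (μ.root w) (μ.root z) :=
  (μ.reachIn_step h).subset (Set.union_subset ((μ.out_subset w).trans (μ.branch_subset_cover hw))
    ((μ.in_subset z).trans (μ.branch_subset_cover hz)))

theorem reachIn_cover {Z : Set W} {u w : W} (h : ReachIn H.Adj Z u w) :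
    ReachIn D.Adj (μ.cover Z) (μ.root u) (μ.root w) := by
  induction h with
  | refl => exact .refl _ _ _
  | tail _ h ih => exact ih.trans (μ.reachIn_cover_step h.1 h.2.1 h.2.2)

theorem reachIn_weak_cover {Z : Set W} {u w : W} (h : ReachIn (WeakAdj H) Z u w) :
    ReachIn (WeakAdj D) (μ.cover Z) (μ.root u) (μ.root w) := by
  induction h with
  | refl => exact .refl _ _ _
  | tail _ h ih =>
    obtain ⟨h | h, hb, hc⟩ := h
    · exact ih.trans (μ.reachIn_cover_step h hb hc).weak
    · exact ih.trans (μ.reachIn_cover_step h hc hb).weak.weak_symm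

/-- The vertices that can be used for entering the root of `w` from the roots of `Z`. -/
def inSide (Z : Set W) (w : W) : Set V := μ.cover (Z \ {w}) ∪ (μ.inTree w).verts

/-- The vertices that can be used for going from the root of `w` to the roots of `Z`. -/
def outSide (Z : Set W) (w : W) : Set V := μ.cover (Z \ {w}) ∪ (μ.outTree w).verts

/-- The walk is stopped at its first visit to `w`, so the out-arborescence of `w` is never needed.
-/
theorem reachIn_inSide {Z : Set W} {u w : W} (h : ReachIn H.Adj Z u w) :
    ReachIn D.Adj (μ.inSide Z w) (μ.root u) (μ.root w) := by
  induction h using ReflTransGen.head_induction_on with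
  | refl => exact .refl _ _ _
  | @head a c h _ ih =>
    by_cases ha : a = w
    · subst ha; exact .refl _ _ _
    refine ((μ.reachIn_step h.1).subset (Set.union_subset ?_ ?_)).trans ih
    · exact (μ.out_subset a).trans ((μ.branch_subset_cover (Z := Z \ {w}) ⟨h.2.1, ha⟩).trans
        Set.subset_union_left)
    · by_cases hc : c = w
      · subst hc; exact Set.subset_union_right
      · exact (μ.in_subset c).trans ((μ.branch_subset_cover (Z := Z \ {w}) ⟨h.2.2, hc⟩).trans
          Set.subset_union_left)

theorem mem_in_of_mem_inSide {Z : Set W} {w : W} {x : V} (h : x ∈ μ.inSide Z w)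
    (hx : x ∈ μ.branch w) : x ∈ (μ.inTree w).verts := by
  rcases h with h | h
  · obtain ⟨z, hz, hxz⟩ := μ.mem_cover.1 h
    exact absurd (μ.eq_of_mem_branch hxz hx) hz.2
  · exact h

theorem mem_out_of_mem_outSide {Z : Set W} {w : W} {x : V} (h : x ∈ μ.outSide Z w)
    (hx : x ∈ μ.branch w) : x ∈ (μ.outTree w).verts := by
  rcases h with h | h
  · obtain ⟨z, hz, hxz⟩ := μ.mem_cover.1 h
    exact absurd (μ.eq_of_mem_branch hxz hx) hz.2
  · exact h

/-- Outside the branch set of `w` the two sides are covered by branch sets of distinct vertices;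
inside it they are the two arborescences, which share only the root. -/
theorem eq_root_of_mem_sides {Z Z' : Set W} {w : W} {x : V} (h : x ∈ μ.inSide Z w)
    (h' : x ∈ μ.outSide Z' w) (hZ : Z ∩ Z' ⊆ {w}) : x = μ.root w := by
  by_cases hx : x ∈ μ.branch w
  · exact μ.eq_root (μ.mem_in_of_mem_inSide h hx) (μ.mem_out_of_mem_outSide h' hx)
  · rcases h with h | h
    · rcases h' with h' | h'
      · obtain ⟨z, hz, hxz⟩ := μ.mem_cover.1 h
        obtain ⟨z', hz', hxz'⟩ := μ.mem_cover.1 h'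
        obtain rfl := μ.eq_of_mem_branch hxz hxz'
        exact absurd (hZ ⟨hz.1, hz'.1⟩) hz.2
      · exact absurd (Or.inr h') hx
    · exact absurd (Or.inl h) hx

theorem mem_cover_of_mem_inSide {Z : Set W} {w : W} {x : V} (h : x ∈ μ.inSide Z w) :
    x ∈ μ.cover Set.univ := by
  rcases h with h | h
  · obtain ⟨z, -, hxz⟩ := μ.mem_cover.1 h
    exact μ.mem_cover.2 ⟨z, trivial, hxz⟩
  · exact μ.mem_cover.2 ⟨w, trivial, Or.inl h⟩

theorem finite_setOf_branch_meets {Q : Set V} (hQ : Q.Finite) :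
    {w | ∃ x ∈ Q, x ∈ μ.branch w}.Finite := by
  have hf : ∀ w, ∃ x, (∃ x ∈ Q, x ∈ μ.branch w) → x ∈ Q ∧ x ∈ μ.branch w := fun w => by
    by_cases h : ∃ x ∈ Q, x ∈ μ.branch w
    · obtain ⟨x, hx⟩ := h
      exact ⟨x, fun _ => hx⟩
    -- A default value for branch sets that miss `Q`.
    · exact ⟨μ.root w, fun h' => absurd h' h⟩
  choose f hf using hf
  refine Set.Finite.of_injOn (f := f) (t := Q) (fun w hw => (hf w hw).1) ?_ hQ
  intro w hw z hz h
  exact μ.eq_of_mem_branch (hf w hw).2 (h ▸ (hf z hz).2)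

/-- A finite in-arborescence would have a finite in-neighbourhood in `D`, which meets only finitely
many of the disjoint branch sets. -/
theorem inTree_infinite (hD : ∀ p, {q | D.Adj q p}.Finite) {r : W}
    (hr : {z | H.Adj z r}.Infinite) : (μ.inTree r).verts.Infinite := by
  intro hfin
  refine hr ((μ.finite_setOf_branch_meets (hfin.biUnion fun p _ => hD p)).subset fun z hz => ?_)
  exact ⟨μ.edgeTail hz, Set.mem_biUnion (μ.edgeHead_mem hz) (μ.edge_adj hz),
    μ.out_subset z (μ.edgeTail_mem hz)⟩

/-- The model obtained by reversing all edges. -/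
def reverse : TreeLikeModel (rev H) (rev D) where
  root := μ.root
  inTree w := ⟨(μ.outTree w).verts, fun x y => (μ.outTree w).Adj y x, (μ.outTree w).adj_sub,
    (μ.outTree w).snd_mem, (μ.outTree w).fst_mem⟩
  outTree w := ⟨(μ.inTree w).verts, fun x y => (μ.inTree w).Adj y x, (μ.inTree w).adj_sub,
    (μ.inTree w).snd_mem, (μ.inTree w).fst_mem⟩
  isIn w := ⟨(μ.isOut w).root_mem, (μ.isOut w).not_adj_root, (μ.isOut w).unique_in,
    fun x hx => reflTransGen_swap ((μ.isOut w).reachable x hx)⟩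
  isOut w := ⟨(μ.isIn w).root_mem, (μ.isIn w).not_root_adj, (μ.isIn w).unique_out,
    fun x hx => reflTransGen_swap ((μ.isIn w).reachable x hx)⟩
  inter w := by rw [Set.inter_comm]; exact μ.inter w
  disjoint w z h := by
    rw [Set.union_comm, Set.union_comm (μ.outTree z).verts]; exact μ.disjoint w z h
  edgeTail e := μ.edgeHead e
  edgeHead e := μ.edgeTail e
  edge_adj e := μ.edge_adj e
  edgeTail_mem e := μ.edgeHead_mem e
  edgeHead_mem e := μ.edgeTail_mem e

theorem cover_reverse (Z : Set W) : μ.reverse.cover Z = μ.cover Z := by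
  ext x
  simp only [mem_cover]
  exact exists_congr fun z => and_congr_right fun _ => or_comm

theorem reachIn_outSide {Z : Set W} {u w : W} (h : ReachIn H.Adj Z w u) :
    ReachIn D.Adj (μ.outSide Z w) (μ.root w) (μ.root u) := by
  have := (μ.reverse.reachIn_inSide (Z := Z) (u := u) (w := w) h.swap).swap
  rw [inSide, cover_reverse] at this
  exact this

theorem outTree_infinite (hD : ∀ p, {q | D.Adj p q}.Finite) {r : W}
    (hr : {z | H.Adj r z}.Infinite) : (μ.outTree r).verts.Infinite :=
  μ.reverse.inTree_infinite hD hr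

/-- Transport of a model along an isomorphism of the minor. -/
def mapGuest {W' : Type*} {H' : Digraph W'} (φ : H'.Adj ≃r H.Adj) : TreeLikeModel H' D where
  root w := μ.root (φ w)
  inTree w := μ.inTree (φ w)
  outTree w := μ.outTree (φ w)
  isIn w := μ.isIn (φ w)
  isOut w := μ.isOut (φ w)
  inter w := μ.inter (φ w)
  disjoint w z h := μ.disjoint (φ w) (φ z) fun h' => h (φ.injective h')
  edgeTail e := μ.edgeTail (φ.map_rel_iff.2 e)
  edgeHead e := μ.edgeHead (φ.map_rel_iff.2 e)
  edge_adj e := μ.edge_adj (φ.map_rel_iff.2 e)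
  edgeTail_mem e := μ.edgeTail_mem (φ.map_rel_iff.2 e)
  edgeHead_mem e := μ.edgeHead_mem (φ.map_rel_iff.2 e)

theorem range_root_mapGuest {W' : Type*} {H' : Digraph W'} (φ : H'.Adj ≃r H.Adj) :
    Set.range (μ.mapGuest φ).root = Set.range μ.root :=
  φ.surjective.range_comp μ.root

end TreeLikeModel

/-! ### Transport of models to isomorphic hosts -/

/-- The preimage of a subdigraph under an isomorphism. -/
def Subdigraph.comap {V : Type u} {B : Type v} {D : Digraph V} {K : Digraph B}
    (φ : K.Adj ≃r D.Adj) (T : Subdigraph D) : Subdigraph K where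
  verts := φ ⁻¹' T.verts
  Adj x y := T.Adj (φ x) (φ y)
  adj_sub h := φ.map_rel_iff.1 (T.adj_sub h)
  fst_mem h := T.fst_mem h
  snd_mem h := T.snd_mem h

theorem Subdigraph.comap_reachable {V : Type u} {B : Type v} {D : Digraph V} {K : Digraph B}
    (φ : K.Adj ≃r D.Adj) (T : Subdigraph D) {x y : V} (h : ReflTransGen T.Adj x y) :
    ReflTransGen (T.comap φ).Adj (φ.symm x) (φ.symm y) :=
  reflTransGen_map φ.symm (fun a b h => by simpa [Subdigraph.comap] using h) h

/-- Transport of a model along an isomorphism of the host. -/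
def TreeLikeModel.mapHost {W : Type*} {V : Type u} {B : Type v} {H : Digraph W} {D : Digraph V}
    {K : Digraph B} (φ : K.Adj ≃r D.Adj) (μ : TreeLikeModel H D) : TreeLikeModel H K where
  root w := φ.symm (μ.root w)
  inTree w := (μ.inTree w).comap φ
  outTree w := (μ.outTree w).comap φ
  isIn w := by
    refine ⟨?_, fun x h => (μ.isIn w).not_root_adj (φ x) ?_, fun {x y z} h h' => φ.injective
      ((μ.isIn w).unique_out h h'), fun x hx => ?_⟩
    · simpa [Subdigraph.comap] using (μ.isIn w).root_mem
    · simpa [Subdigraph.comap] using h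
    · simpa using (μ.inTree w).comap_reachable φ ((μ.isIn w).reachable (φ x) hx)
  isOut w := by
    refine ⟨?_, fun x h => (μ.isOut w).not_adj_root (φ x) ?_, fun {x y z} h h' => φ.injective
      ((μ.isOut w).unique_in h h'), fun x hx => ?_⟩
    · simpa [Subdigraph.comap] using (μ.isOut w).root_mem
    · simpa [Subdigraph.comap] using h
    · simpa using (μ.outTree w).comap_reachable φ ((μ.isOut w).reachable (φ x) hx)
  inter w := by
    have : φ ⁻¹' ((μ.inTree w).verts ∩ (μ.outTree w).verts) = {φ.symm (μ.root w)} := by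
      rw [μ.inter w]; ext x; simp [RelIso.eq_symm_apply]
    exact this
  disjoint w z h := (μ.disjoint w z h).preimage φ
  edgeTail e := φ.symm (μ.edgeTail e)
  edgeHead e := φ.symm (μ.edgeHead e)
  edge_adj e := φ.symm.map_rel_iff.2 (μ.edge_adj e)
  edgeTail_mem e := by simpa [Subdigraph.comap] using μ.edgeTail_mem e
  edgeHead_mem e := by simpa [Subdigraph.comap] using μ.edgeHead_mem e

theorem TreeLikeModel.teeth_mapHost {W : Type*} {V : Type u} {B : Type v} {H : Digraph W}
    {D : Digraph V} {K : Digraph B} (φ : K.Adj ≃r D.Adj) (μ : TreeLikeModel H D) (S : Set B)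
    (h : (φ '' S ∩ Set.range μ.root).Infinite) : (S ∩ Set.range (μ.mapHost φ).root).Infinite := by
  refine (h.image φ.symm.injective.injOn).mono ?_
  rintro _ ⟨_, ⟨⟨s, hs, rfl⟩, w, hw⟩, rfl⟩
  refine ⟨by simpa using hs, w, ?_⟩
  simp [mapHost, hw]

/-! ### Properties of digraphs that distinguish the six types -/

/-- Every finite vertex set `F` lies in a finite set that is separated from the other vertices by
one of its vertices outside `F`. -/
def CutVertexExhausted {V : Type u} (D : Digraph V) : Prop :=
  ∀ F : Set V, F.Finite → ∃ S : Set V, S.Finite ∧ F ⊆ S ∧ ∃ s ∈ S, s ∉ F ∧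
    ∀ x ∈ S, ∀ y ∉ S, WeakAdj D x y → x = s

/-- There are infinitely many vertices `v i` such that no vertex separates infinitely many `v i`
from `v (i + 1)` or infinitely many `v (i + 1)` from `v i`. -/
def HasStrongRay {V : Type u} (D : Digraph V) : Prop :=
  ∃ v : ℕ → V, Function.Injective v ∧ ∀ y, ∃ N, ∀ i ≥ N,
    ReachIn D.Adj {y}ᶜ (v i) (v (i + 1)) ∧ ReachIn D.Adj {y}ᶜ (v (i + 1)) (v i)

/-- There are infinitely many vertices `v i` such that no vertex separates infinitely many `v i`
from `v (i + 1)` in the underlying undirected graph. -/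
def HasWeakRay {V : Type u} (D : Digraph V) : Prop :=
  ∃ v : ℕ → V, Function.Injective v ∧ ∀ y, ∃ N, ∀ i ≥ N,
    ReachIn (WeakAdj D) {y}ᶜ (v i) (v (i + 1))

/-- There is a directed cycle of length three. -/
def HasTriangle {V : Type u} (D : Digraph V) : Prop :=
  ∃ t : Fin 3 → V, Function.Injective t ∧ ∀ i, D.Adj (t i) (t (i + 1))

/-- There are disjoint directed cycles of length two. -/
def HasDisjointDigons {V : Type u} (D : Digraph V) : Prop :=
  ∃ x y x' y' : V, x ≠ y ∧ x' ≠ y' ∧ Disjoint ({x, y} : Set V) {x', y'} ∧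
    D.Adj x y ∧ D.Adj y x ∧ D.Adj x' y' ∧ D.Adj y' x'

/-- The digraph is infinite, and deleting one vertex does not disconnect its underlying undirected
graph. -/
def WeaklyTwoConnected {V : Type u} (D : Digraph V) : Prop :=
  Infinite V ∧ ∀ v x y : V, x ≠ v → y ≠ v → ReachIn (WeakAdj D) {v}ᶜ x y

/-- The colour classes of `c` are joined only by the edges of the directed cycle
`t 0, t 1, t 2`. -/
structure IsTrisection {V : Type u} (D : Digraph V) (c : V → Fin 3) (t : Fin 3 → V) : Prop where
  color : ∀ i, c (t i) = i
  cross : ∀ {x y}, D.Adj x y → c x ≠ c y → ∃ i, x = t i ∧ y = t (i + 1)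

theorem HasStrongRay.weak {V : Type u} {D : Digraph V} (h : HasStrongRay D) : HasWeakRay D := by
  obtain ⟨v, hv, h⟩ := h
  refine ⟨v, hv, fun y => ?_⟩
  obtain ⟨N, hN⟩ := h y
  exact ⟨N, fun i hi => (hN i hi).1.weak⟩

theorem HasStrongRay.rev {V : Type u} {D : Digraph V} (h : HasStrongRay D) :
    HasStrongRay (rev D) := by
  obtain ⟨v, hv, h⟩ := h
  refine ⟨v, hv, fun y => ?_⟩
  obtain ⟨N, hN⟩ := h y
  exact ⟨N, fun i hi => ⟨(hN i hi).2.swap, (hN i hi).1.swap⟩⟩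

theorem reflTransGen_of_le {V : Type u} {R : V → V → Prop} {v : ℕ → V}
    (h : ∀ n, ReflTransGen R (v n) (v (n + 1))) {m n : ℕ} (hmn : m ≤ n) :
    ReflTransGen R (v m) (v n) := by
  induction n, hmn using Nat.le_induction with
  | base => exact .refl
  | succ n _ ih => exact ih.trans (h n)

theorem reflTransGen_of_ge {V : Type u} {R : V → V → Prop} {v : ℕ → V}
    (h : ∀ n, ReflTransGen R (v (n + 1)) (v n)) {m n : ℕ} (hmn : m ≤ n) :
    ReflTransGen R (v n) (v m) := by
  induction n, hmn using Nat.le_induction with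
  | base => exact .refl
  | succ n _ ih => exact (h n).trans ih

theorem stronglyConnected_of_sequence {V : Type u} {D : Digraph V} (v : ℕ → V)
    (hv : ∀ x, ∃ n, ReflTransGen D.Adj x (v n) ∧ ReflTransGen D.Adj (v n) x)
    (h : ∀ n, ReflTransGen D.Adj (v n) (v (n + 1)) ∧ ReflTransGen D.Adj (v (n + 1)) (v n)) :
    StronglyConnected D := by
  intro x y
  obtain ⟨m, hm, -⟩ := hv x
  obtain ⟨n, -, hn⟩ := hv y
  rcases le_total m n with hmn | hmn
  · exact hm.trans ((reflTransGen_of_le (fun n => (h n).1) hmn).trans hn)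
  · exact hm.trans ((reflTransGen_of_ge (fun n => (h n).2) hmn).trans hn)

theorem ReachIn.reflTransGen {V : Type u} {R : V → V → Prop} {A : Set V} {x y : V}
    (h : ReachIn R A x y) : ReflTransGen R x y :=
  reflTransGen_map id (fun _ _ h => h.1) h

/-! ### Digraphs with attached double paths -/

section Attach

variable {B I : Type u} (K : Digraph B) (β : I → B) (len : I → ℕ)

/-- The vertex of the core to which the double path containing a vertex is attached. -/
def base : B ⊕ (Σ i : I, Fin (len i)) → B := Sum.elim id fun x => β x.1

/-- The vertices of the `i`-th attached double path outside the core. -/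
def pendant (i : I) : Set (B ⊕ (Σ i : I, Fin (len i))) := Set.range fun k => Sum.inr ⟨i, k⟩

@[simp] theorem base_inl (b : B) : base β len (Sum.inl b) = b := rfl

@[simp] theorem base_inr (x : Σ i : I, Fin (len i)) : base β len (Sum.inr x) = β x.1 := rfl

@[simp] theorem base_lastVertex (i : I) : base β len (lastVertex β len i) = β i := by
  unfold lastVertex
  split <;> rfl

theorem lastVertex_injective (hβ : Function.Injective β) :
    Function.Injective (lastVertex β len) := fun i j h => by
  apply hβ
  rw [← base_lastVertex β len, h, base_lastVertex]

theorem lastVertex_mem_pendant {i : I} (h : 0 < len i) : lastVertex β len i ∈ pendant len i := by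
  unfold lastVertex
  rw [dif_pos h]
  exact ⟨_, rfl⟩

theorem lastVertex_injective_of_pos (h : ∀ i, 0 < len i) :
    Function.Injective (lastVertex β len) := fun i j hij => by
  obtain ⟨k, hk⟩ := lastVertex_mem_pendant β len (h i)
  obtain ⟨l, hl⟩ := lastVertex_mem_pendant β len (h j)
  have := hk.trans (hij.trans hl.symm)
  exact congrArg Sigma.fst (Sum.inr_injective this)

theorem pendant_finite (i : I) :
    (pendant len i : Set (B ⊕ (Σ i : I, Fin (len i)))).Finite := Set.finite_range _

theorem finite_base_preimage (hβ : Function.Injective β) {F : Set B} (hF : F.Finite) :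
    (base β len ⁻¹' F).Finite := by
  refine ((hF.image Sum.inl).union
    ((hF.preimage hβ.injOn).biUnion fun i _ => pendant_finite len i)).subset ?_
  rintro (b | ⟨i, k⟩) h
  · exact Or.inl ⟨b, h, rfl⟩
  · exact Or.inr (Set.mem_biUnion (show i ∈ β ⁻¹' F from h) ⟨k, rfl⟩)

variable {K β len} {x y : B ⊕ (Σ i : I, Fin (len i))}

/-- Collapsing the pendant paths by `base` contracts all new edges, so separations of the core pull
back along `base`. -/
theorem attach_adj_cases (h : (attach K β len).Adj x y) :
    base β len x = base β len y ∨ ∃ p q, x = Sum.inl p ∧ y = Sum.inl q ∧ K.Adj p q := by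
  cases h with
  | core h => exact Or.inr ⟨_, _, rfl, rfl, h⟩
  | firstOut => exact Or.inl rfl
  | firstIn => exact Or.inl rfl
  | stepOut => exact Or.inl rfl
  | stepIn => exact Or.inl rfl

theorem attach_adj_of_base_ne (h : (attach K β len).Adj x y) (hne : base β len x ≠ base β len y) :
    ∃ p q, x = Sum.inl p ∧ y = Sum.inl q ∧ K.Adj p q :=
  (attach_adj_cases h).resolve_left hne

theorem attach_adj_inl_iff {p q : B} :
    (attach K β len).Adj (Sum.inl p) (Sum.inl q) ↔ K.Adj p q :=
  ⟨fun h => by cases h; assumption, AttachAdj.core⟩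

theorem eq_of_weakAdj_pendant {i : I} (h : WeakAdj (attach K β len) x y)
    (hx : x ∈ pendant len i) (hy : y ∉ pendant len i) : y = Sum.inl (β i) := by
  obtain ⟨k, rfl⟩ := hx
  rcases h with h | h <;> cases h
  · rfl
  · exact absurd ⟨_, rfl⟩ hy
  · exact absurd ⟨_, rfl⟩ hy
  · rfl
  · exact absurd ⟨_, rfl⟩ hy
  · exact absurd ⟨_, rfl⟩ hy

theorem attach_reach_inl {A : Set B} {p q : B} (h : ReachIn K.Adj A p q) :
    ReachIn (attach K β len).Adj (Sum.inl '' A) (Sum.inl p) (Sum.inl q) :=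
  reflTransGen_map Sum.inl (fun _ _ h => ⟨.core h.1, ⟨_, h.2.1, rfl⟩, ⟨_, h.2.2, rfl⟩⟩) h

theorem attach_pendant_reach (i : I) : ∀ (k : ℕ) (hk : k < len i),
    ReflTransGen (attach K β len).Adj (Sum.inl (β i)) (Sum.inr ⟨i, ⟨k, hk⟩⟩) ∧
    ReflTransGen (attach K β len).Adj (Sum.inr ⟨i, ⟨k, hk⟩⟩) (Sum.inl (β i))
  | 0, hk => ⟨.single (.firstOut i hk), .single (.firstIn i hk)⟩
  | k + 1, hk =>
    have ih := attach_pendant_reach i k (by omega)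
    ⟨ih.1.tail (.stepOut i k hk), ih.2.head (.stepIn i k hk)⟩

theorem attach_stronglyConnected (hK : StronglyConnected K) :
    StronglyConnected (attach K β len) := by
  have key : ∀ x, ReflTransGen (attach K β len).Adj x (Sum.inl (base β len x)) ∧
      ReflTransGen (attach K β len).Adj (Sum.inl (base β len x)) x := by
    rintro (b | ⟨i, k⟩)
    · exact ⟨.refl, .refl⟩
    · exact (attach_pendant_reach i k.1 k.2).symm
  exact fun x y => (key x).1.trans ((reflTransGen_map Sum.inl (fun _ _ h => .core h)
    (hK _ _)).trans (key y).2)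

theorem attach_cutVertexExhausted (hβ : Function.Injective β) (hK : CutVertexExhausted K) :
    CutVertexExhausted (attach K β len) := by
  intro F hF
  obtain ⟨S, hS, hFS, s, hs, hsF, h⟩ := hK (base β len '' F) (hF.image _)
  refine ⟨base β len ⁻¹' S, finite_base_preimage β len hβ hS, Set.image_subset_iff.1 hFS,
    Sum.inl s, hs, fun h' => hsF ⟨_, h', rfl⟩, fun x hx y hy hxy => ?_⟩
  have hne : base β len x ≠ base β len y := fun h' => hy (by
    rw [Set.mem_preimage, ← h']; exact hx)
  rcases hxy with hxy | hxy
  · obtain ⟨p, q, rfl, rfl, hpq⟩ := attach_adj_of_base_ne hxy hne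
    exact congrArg _ (h p hx q hy (Or.inl hpq))
  · obtain ⟨p, q, rfl, rfl, hpq⟩ := attach_adj_of_base_ne hxy hne.symm
    exact congrArg _ (h q hx p hy (Or.inr hpq))

theorem attach_hasStrongRay (hK : HasStrongRay K) : HasStrongRay (attach K β len) := by
  obtain ⟨v, hv, h⟩ := hK
  refine ⟨fun i => Sum.inl (v i), fun i j h => hv (Sum.inl_injective h), fun y => ?_⟩
  obtain ⟨N, hN⟩ := h (base β len y)
  have hsub : (Sum.inl '' {base β len y}ᶜ : Set (B ⊕ (Σ i : I, Fin (len i)))) ⊆ {y}ᶜ := by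
    rintro _ ⟨b, hb, rfl⟩ rfl
    exact hb rfl
  exact ⟨N, fun i hi => ⟨(attach_reach_inl (hN i hi).1).subset hsub,
    (attach_reach_inl (hN i hi).2).subset hsub⟩⟩

theorem attach_hasTriangle (hK : HasTriangle K) : HasTriangle (attach K β len) := by
  obtain ⟨t, ht, h⟩ := hK
  exact ⟨fun i => Sum.inl (t i), fun i j h => ht (Sum.inl_injective h), fun i => .core (h i)⟩

theorem rev_attach : rev (attach K β len) = attach (rev K) β len := by
  ext x y
  constructor <;> intro h <;> cases h
  · exact .core (by assumption)
  · exact .firstIn _ _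
  · exact .firstOut _ _
  · exact .stepIn _ _ _
  · exact .stepOut _ _ _
  · exact .core (by assumption)
  · exact .firstIn _ _
  · exact .firstOut _ _
  · exact .stepIn _ _ _
  · exact .stepOut _ _ _

end Attach

/-! ### The double ray -/

theorem exists_forall_lt_of_finite {V : Type u} {F : Set V} (hF : F.Finite) (f : V → ℕ) :
    ∃ n, ∀ x ∈ F, f x < n := by
  obtain ⟨n, hn⟩ := (hF.image f).bddAbove
  exact ⟨n + 1, fun x hx => Nat.lt_succ_of_le (hn ⟨x, hx, rfl⟩)⟩

theorem doubleRay_cutVertexExhausted : CutVertexExhausted doubleRay := by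
  intro F hF
  obtain ⟨n, hn⟩ := exists_forall_lt_of_finite hF id
  refine ⟨Set.Iic n, Set.finite_Iic n, fun x hx => (hn x hx).le, n, Set.mem_Iic.2 le_rfl,
    fun h => (hn n h).false, fun x hx y hy h => ?_⟩
  simp only [Set.mem_Iic, WeakAdj, doubleRay] at *
  omega

theorem doubleRay_hasStrongRay : HasStrongRay doubleRay := by
  refine ⟨id, fun _ _ h => h, fun y => ⟨y + 1, fun i hi => ?_⟩⟩
  have h1 : i ∈ ({y}ᶜ : Set ℕ) := by simp only [Set.mem_compl_iff, Set.mem_singleton_iff]; omega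
  have h2 : i + 1 ∈ ({y}ᶜ : Set ℕ) := by
    simp only [Set.mem_compl_iff, Set.mem_singleton_iff]; omega
  exact ⟨.single (Or.inl rfl) h1 h2, .single (Or.inr rfl) h2 h1⟩

theorem doubleRay_stronglyConnected : StronglyConnected doubleRay :=
  stronglyConnected_of_sequence id (fun x => ⟨x, .refl, .refl⟩)
    fun _ => ⟨.single (Or.inl rfl), .single (Or.inr rfl)⟩

/-- The underlying tree is bipartite; `par` has the parity of the distance from the first vertex of
the ray. -/
theorem comb_not_hasTriangle {J : Set ℕ} (len : J → ℕ) :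
    ¬ HasTriangle (attach doubleRay (fun j : J => (j : ℕ)) len) := by
  rintro ⟨t, -, h⟩
  let par : ℕ ⊕ (Σ i : J, Fin (len i)) → ℕ := Sum.elim id fun x => x.1 + x.2 + 1
  have key : ∀ x y, (attach doubleRay (fun j : J => (j : ℕ)) len).Adj x y →
      (par x + par y) % 2 = 1 := by
    intro x y h
    cases h with
    | core h => simp only [doubleRay] at h; simp only [par, Sum.elim_inl, id]; omega
    | firstOut => simp only [par, Sum.elim_inl, Sum.elim_inr, id]; omega
    | firstIn => simp only [par, Sum.elim_inl, Sum.elim_inr, id]; omega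
    | stepOut => simp only [par, Sum.elim_inr]; omega
    | stepIn => simp only [par, Sum.elim_inr]; omega
  have h0 := key _ _ (h 0)
  have h1 := key _ _ (h 1)
  have h2 := key _ _ (h 2)
  simp only [Fin.isValue, zero_add, Fin.reduceAdd] at h0 h1 h2
  omega

/-! ### Bridges in combs -/

/-- The distance of a vertex of the `i`-th attached double path from the core, and `0` for all other
vertices. -/
def height {B I : Type u} [DecidableEq I] (len : I → ℕ) (i : I) :
    B ⊕ (Σ i : I, Fin (len i)) → ℕ :=
  Sum.elim (fun _ => 0) fun x => if x.1 = i then x.2 + 1 else 0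

/-- Every edge of the underlying undirected graph is a bridge. -/
def AllBridges {V : Type u} (D : Digraph V) : Prop :=
  ∀ x y, D.Adj x y → ∃ S : Set V, x ∈ S ∧ y ∉ S ∧ ∀ p ∈ S, ∀ q ∉ S, WeakAdj D p q → p = x ∧ q = y

/-- The vertex with index `k` on a pendant path has height `k + 1`, so the only edge between heights
at most `k` and heights above `k` ends at index `k`; it starts in the core if `k = 0`. -/
theorem pendant_bridge {B I : Type u} [DecidableEq I] {K : Digraph B} {β : I → B} {len : I → ℕ}
    {i : I} {k : ℕ} {p q : B ⊕ (Σ i : I, Fin (len i))} (hp : height len i p ≤ k)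
    (hq : k < height len i q) (h : WeakAdj (attach K β len) p q) :
    (k = 0 ∧ p = Sum.inl (β i) ∨ ∃ h, p = Sum.inr ⟨i, ⟨k - 1, h⟩⟩ ∧ 0 < k) ∧
      ∃ h, q = Sum.inr ⟨i, ⟨k, h⟩⟩ := by
  have hh := h
  rcases h with h | h <;> cases h <;>
    simp only [height, Sum.elim_inl, Sum.elim_inr] at hp hq <;>
    (try split_ifs at hp hq with hi) <;> try omega
  all_goals subst hi
  · obtain rfl : k = 0 := by omega
    exact ⟨Or.inl ⟨rfl, rfl⟩, _, rfl⟩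
  · rename_i j _
    obtain rfl : k = j + 1 := by omega
    exact ⟨Or.inr ⟨by omega, rfl, by omega⟩, by omega, rfl⟩
  · obtain rfl : k = 0 := by omega
    exact ⟨Or.inl ⟨rfl, rfl⟩, _, rfl⟩
  · rename_i j _
    obtain rfl : k = j + 1 := by omega
    exact ⟨Or.inr ⟨by omega, rfl, by omega⟩, by omega, rfl⟩

theorem comb_allBridges {J : Set ℕ} (len : J → ℕ) :
    AllBridges (attach doubleRay (fun j : J => (j : ℕ)) len) := by
  classical
  set G := attach doubleRay (fun j : J => (j : ℕ)) len with hG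
  -- Complementing `S` turns a witness for one direction of a double edge into a witness for the
  -- other.
  have hcompl : ∀ x y, (∃ S : Set (ℕ ⊕ (Σ i : J, Fin (len i))), x ∈ S ∧ y ∉ S ∧ ∀ p ∈ S, ∀ q ∉ S,
      WeakAdj G p q → p = x ∧ q = y) →
      ∃ S : Set (ℕ ⊕ (Σ i : J, Fin (len i))), y ∈ S ∧ x ∉ S ∧ ∀ p ∈ S, ∀ q ∉ S,
      WeakAdj G p q → p = y ∧ q = x := by
    rintro x y ⟨S, hx, hy, h⟩
    exact ⟨Sᶜ, hy, fun h' => h' hx, fun p hp q hq hpq =>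
      (h q (not_not.1 hq) p hp hpq.symm).symm⟩
  have hcore : ∀ n, ∃ S : Set (ℕ ⊕ (Σ i : J, Fin (len i))), Sum.inl n ∈ S ∧ Sum.inl (n + 1) ∉ S ∧
      ∀ p ∈ S, ∀ q ∉ S, WeakAdj G p q → p = Sum.inl n ∧ q = Sum.inl (n + 1) := by
    intro n
    refine ⟨{x | base (fun j : J => (j : ℕ)) len x ≤ n}, le_refl n, fun h => ?_,
      fun p hp q hq h => ?_⟩
    · simp only [Set.mem_ofPred_eq, base_inl] at h; omega
    · have hne : base (fun j : J => (j : ℕ)) len p ≠ base (fun j : J => (j : ℕ)) len q :=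
        fun h' => hq (by rw [Set.mem_ofPred_eq, ← h']; exact hp)
      rcases h with h | h
      · obtain ⟨a, b, rfl, rfl, hab⟩ := attach_adj_of_base_ne h hne
        simp only [Set.mem_ofPred_eq, base_inl, doubleRay] at hp hq hab
        exact ⟨congrArg _ (by omega), congrArg _ (by omega)⟩
      · obtain ⟨b, a, rfl, rfl, hab⟩ := attach_adj_of_base_ne h hne.symm
        simp only [Set.mem_ofPred_eq, base_inl, doubleRay] at hp hq hab
        exact ⟨congrArg _ (by omega), congrArg _ (by omega)⟩
  have hfirst : ∀ (i : J) (hi : 0 < len i), ∃ S : Set (ℕ ⊕ (Σ i : J, Fin (len i))),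
      Sum.inl (i : ℕ) ∈ S ∧ Sum.inr ⟨i, ⟨0, hi⟩⟩ ∉ S ∧
      ∀ p ∈ S, ∀ q ∉ S, WeakAdj G p q → p = Sum.inl (i : ℕ) ∧ q = Sum.inr ⟨i, ⟨0, hi⟩⟩ := by
    intro i hi
    refine ⟨{x | height len i x ≤ 0}, by simp [height], by simp [height], fun p hp q hq h => ?_⟩
    obtain ⟨h1 | ⟨_, h1⟩, _, h2⟩ := pendant_bridge hp (not_le.1 hq) h
    · exact ⟨h1.2, h2⟩
    · exact absurd h1.2 (lt_irrefl 0)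
  have hstep : ∀ (i : J) (k : ℕ) (hk : k + 1 < len i), ∃ S : Set (ℕ ⊕ (Σ i : J, Fin (len i))),
      Sum.inr ⟨i, ⟨k, by omega⟩⟩ ∈ S ∧ Sum.inr ⟨i, ⟨k + 1, hk⟩⟩ ∉ S ∧
      ∀ p ∈ S, ∀ q ∉ S, WeakAdj G p q →
        p = Sum.inr ⟨i, ⟨k, by omega⟩⟩ ∧ q = Sum.inr ⟨i, ⟨k + 1, hk⟩⟩ := by
    intro i k hk
    refine ⟨{x | height len i x ≤ k + 1}, by simp [height], by simp [height],
      fun p hp q hq h => ?_⟩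
    obtain ⟨h1 | ⟨_, h1⟩, _, h2⟩ := pendant_bridge hp (not_le.1 hq) h
    · exact absurd h1.1 (by omega)
    · exact ⟨h1.1, h2⟩
  intro x y h
  cases h with
  | @core a b h =>
    rcases h with rfl | rfl
    · exact hcore a
    · exact hcompl _ _ (hcore b)
  | firstOut i hi => exact hfirst i hi
  | firstIn i hi => exact hcompl _ _ (hfirst i hi)
  | stepOut i k hk => exact hstep i k hk
  | stepIn i k hk => exact hcompl _ _ (hstep i k hk)

/-! ### The dominated directed rays -/

theorem rev_dominatedInRay : rev dominatedInRay = dominatedOutRay := rfl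

theorem dominatedOutRay_stronglyConnected : StronglyConnected dominatedOutRay := by
  have h : ∀ n, ReflTransGen dominatedOutRay.Adj n 0 := fun n => by
    rcases eq_or_ne n 0 with rfl | hn
    · exact .refl
    · exact .single (Or.inr ⟨hn, rfl⟩)
  exact fun x y => (h x).trans (reflTransGen_of_le (v := id) (fun n => .single (Or.inl rfl))
    (Nat.zero_le y))

theorem dominatedInRay_stronglyConnected : StronglyConnected dominatedInRay :=
  stronglyConnected_rev dominatedOutRay_stronglyConnected

theorem infinite_setOf_ne_zero_prop {P : ℕ → Prop} (h : ∀ n, n ≠ 0 → P n) :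
    {n | P n}.Infinite :=
  (Set.Ioi_infinite 0).mono fun n hn => h n (Nat.pos_iff_ne_zero.1 hn)

theorem weakAdj_dominatedRay {K : Digraph ℕ} (hK : K = dominatedOutRay ∨ K = dominatedInRay)
    (n : ℕ) : WeakAdj K n (n + 1) ∧ WeakAdj K (n + 1) 0 := by
  rcases hK with rfl | rfl
  · exact ⟨Or.inl (Or.inl rfl), Or.inl (Or.inr ⟨n.succ_ne_zero, rfl⟩)⟩
  · exact ⟨Or.inr (Or.inl rfl), Or.inr (Or.inr ⟨n.succ_ne_zero, rfl⟩)⟩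

/-- Without `0` the ray starting at `1` remains; without any other vertex, everything is still
adjacent to `0`. -/
theorem dominatedRay_weaklyTwoConnected {K : Digraph ℕ}
    (hK : K = dominatedOutRay ∨ K = dominatedInRay) : WeaklyTwoConnected K := by
  refine ⟨inferInstance, fun v => ?_⟩
  have key : ∃ r, ∀ x, x ≠ v → ReachIn (WeakAdj K) {v}ᶜ x r := by
    rcases eq_or_ne v 0 with rfl | hv
    · refine ⟨1, fun x hx => ?_⟩
      induction x with
      | zero => exact absurd rfl hx
      | succ n ih =>
        rcases eq_or_ne n 0 with rfl | hn
        · exact .refl _ _ _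
        · exact (ReachIn.single (weakAdj_dominatedRay hK n).1.symm hx hn).trans (ih hn)
    · refine ⟨0, fun x hx => ?_⟩
      cases x with
      | zero => exact .refl _ _ _
      | succ n => exact .single (weakAdj_dominatedRay hK n).2 hx hv.symm
  obtain ⟨r, hr⟩ := key
  exact fun x y hx hy => (hr x hx).trans (hr y hy).weak_symm

/-! ### Rays with triangles -/

section TriangleRay

variable {J : Set ℕ}

@[simp] theorem leftEnd_fst (n : ℕ) : (leftEnd J n).1.1 = n := rfl

/-- The component containing `x` of the digraph `triangleRay J o` with attached double paths after
the deletion of the edges of the `n`-th triangle, given by a vertex of that triangle. -/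
def side (n : ℕ) (x : TriangleCombVertex J) : Fin 3 :=
  if x.1.1 < n then 0 else if x.1.1 = n then x.1.2 else 1

theorem side_of_lt {n : ℕ} {x : TriangleCombVertex J} (h : x.1.1 < n) : side n x = 0 := if_pos h

theorem side_of_gt {n : ℕ} {x : TriangleCombVertex J} (h : n < x.1.1) : side n x = 1 := by
  rw [side, if_neg (by omega), if_neg (by omega)]

variable [DecidablePred (· ∈ J)] {o : ℕ → Bool}

@[simp] theorem rightEnd_fst (n : ℕ) : (rightEnd J n).1.1 = n := by
  unfold rightEnd; split <;> rfl

@[simp] theorem toothEnd_fst (n : ℕ) : (toothEnd J n).1.1 = n := by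
  unfold toothEnd; split <;> rfl

theorem toothEnd_injective : Function.Injective fun j : J => toothEnd J j := fun i j h => by
  have := congrArg (fun x => x.1.1) h
  simpa [Subtype.ext_iff] using this

theorem triangleRay_reach_part {n : ℕ} {x y : TriangleCombVertex J} (hx : x.1.1 = n)
    (hy : y.1.1 = n) : ReachIn (triangleRay J o).Adj {z | z.1.1 = n} x y := by
  obtain ⟨⟨m, k⟩, hk⟩ := x
  obtain ⟨⟨m', l⟩, hl⟩ := y
  obtain rfl : m = n := hx
  obtain rfl : m' = m := hy
  by_cases h : m' ∈ J ∧ m' ≠ 0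
  · have hfin : ∀ k l : Fin 3, l = k ∨ l = k + 1 ∨ l = k + 1 + 1 := by decide
    cases ho : o m'
    · have step : ∀ k : Fin 3, ReachIn (triangleRay J o).Adj {z | z.1.1 = m'}
          ⟨(m', k + 1), Or.inr h⟩ ⟨(m', k), Or.inr h⟩ := fun k =>
        .single (.cycleRev m' h k ho) rfl rfl
      rcases hfin l k with rfl | rfl | rfl
      · exact .refl _ _ _
      · exact step l
      · exact (step (l + 1)).trans (step l)
    · have step : ∀ k : Fin 3, ReachIn (triangleRay J o).Adj {z | z.1.1 = m'}
          ⟨(m', k), Or.inr h⟩ ⟨(m', k + 1), Or.inr h⟩ := fun k =>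
        .single (.cycle m' h k ho) rfl rfl
      rcases hfin k l with rfl | rfl | rfl
      · exact .refl _ _ _
      · exact step k
      · exact (step k).trans (step (k + 1))
  · obtain rfl : k = 0 := hk.resolve_right h
    obtain rfl : l = 0 := hl.resolve_right h
    exact .refl _ _ _

theorem triangleRay_reach_succ (n : ℕ) :
    ReachIn (triangleRay J o).Adj {z | n ≤ z.1.1} (leftEnd J n) (leftEnd J (n + 1)) ∧
    ReachIn (triangleRay J o).Adj {z | n ≤ z.1.1} (leftEnd J (n + 1)) (leftEnd J n) := by
  have hsub : {z : TriangleCombVertex J | z.1.1 = n} ⊆ {z | n ≤ z.1.1} := fun z hz => ge_of_eq hz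
  have hr : rightEnd J n ∈ {z : TriangleCombVertex J | n ≤ z.1.1} := ge_of_eq (rightEnd_fst n)
  have hl : leftEnd J (n + 1) ∈ {z : TriangleCombVertex J | n ≤ z.1.1} := Nat.le_succ n
  exact ⟨((triangleRay_reach_part (leftEnd_fst n) (rightEnd_fst n)).subset hsub).trans
      (.single (.toRight n) hr hl),
    (ReachIn.single (.toLeft n) hl hr).trans
      ((triangleRay_reach_part (rightEnd_fst n) (leftEnd_fst n)).subset hsub)⟩

theorem triangleRay_hasStrongRay : HasStrongRay (triangleRay J o) := by
  refine ⟨leftEnd J, fun i j h => congrArg (fun x => x.1.1) h, fun y => ⟨y.1.1 + 1,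
    fun i hi => ?_⟩⟩
  have hsub : {z : TriangleCombVertex J | i ≤ z.1.1} ⊆ {y}ᶜ := by
    rintro z hz rfl
    exact absurd (le_trans hi hz) (by omega)
  exact ⟨(triangleRay_reach_succ i).1.subset hsub, (triangleRay_reach_succ i).2.subset hsub⟩

theorem triangleRay_stronglyConnected : StronglyConnected (triangleRay J o) :=
  stronglyConnected_of_sequence (leftEnd J)
    (fun _ => ⟨_, (triangleRay_reach_part rfl (leftEnd_fst _)).reflTransGen,
      (triangleRay_reach_part (leftEnd_fst _) rfl).reflTransGen⟩)
    fun n => ⟨(triangleRay_reach_succ n).1.reflTransGen, (triangleRay_reach_succ n).2.reflTransGen⟩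

theorem triangleRay_cutVertexExhausted : CutVertexExhausted (triangleRay J o) := by
  intro F hF
  obtain ⟨n, hn⟩ := exists_forall_lt_of_finite hF fun x => x.1.1
  refine ⟨{z | z.1.1 ≤ n}, ?_, fun x hx => (hn x hx).le, rightEnd J n, (rightEnd_fst n).le,
    fun h => absurd (hn _ h) (by simp), fun x hx y hy h => ?_⟩
  · exact (((Set.finite_Iic n).prod Set.finite_univ).preimage Subtype.val_injective.injOn).subset
      fun z hz => ⟨hz, trivial⟩
  · simp only [Set.mem_ofPred_eq, not_le] at hx hy
    rcases h with h | h <;> cases h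
    · exact absurd hx (not_le.2 hy)
    · exact absurd hx (not_le.2 hy)
    · simp only [rightEnd_fst, leftEnd_fst] at hx hy
      congr 1; omega
    · simp only [rightEnd_fst, leftEnd_fst] at hx hy
      omega
    · exact absurd hx (not_le.2 hy)
    · exact absurd hx (not_le.2 hy)
    · simp only [rightEnd_fst, leftEnd_fst] at hx hy
      omega
    · simp only [rightEnd_fst, leftEnd_fst] at hx hy
      congr 1; omega

theorem triangleRay_hasTriangle (hJ : J.Infinite) : HasTriangle (triangleRay J o) := by
  obtain ⟨n, hn, h0⟩ := hJ.exists_gt 0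
  have h : n ∈ J ∧ n ≠ 0 := ⟨hn, h0.ne'⟩
  cases ho : o n
  -- Negation in `Fin 3` reverses the cyclic order.
  · refine ⟨fun k => ⟨(n, -k), Or.inr h⟩, fun k l hkl => ?_, fun k => ?_⟩
    · simpa using hkl
    · have hk : ∀ k : Fin 3, -k = -(k + 1) + 1 := by decide
      have := TriangleRayAdj.cycleRev (J := J) (o := o) n h (-(k + 1)) ho
      simp only [← hk k] at this
      exact this
  · refine ⟨fun k => ⟨(n, k), Or.inr h⟩, fun k l hkl => ?_, fun k => .cycle n h k ho⟩
    simpa using hkl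

/-- The double edges between consecutive parts do not change sides, so only the edges of the `n`-th
triangle join different sides. -/
theorem side_rightEnd {n : ℕ} (h : n ∈ J ∧ n ≠ 0) (m : ℕ) :
    side n (rightEnd J m) = side n (leftEnd J (m + 1)) := by
  rcases lt_trichotomy m n with hm | rfl | hm
  · rw [side_of_lt (by rwa [rightEnd_fst])]
    rcases lt_or_eq_of_le (Nat.succ_le_of_lt hm) with hm' | rfl
    · exact (side_of_lt hm').symm
    · simp [side, leftEnd]
  · rw [side_of_gt (show m < (leftEnd J (m + 1)).1.1 from Nat.lt_succ_self m)]
    simp [side, rightEnd, h]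
  · rw [side_of_gt (by rwa [rightEnd_fst]), side_of_gt (hm.trans (Nat.lt_succ_self m))]

/-- The colour is the side with respect to the `n`-th triangle. A vertex to the left, one to the
right and one on the tooth path at `n` together show all three colours. -/
theorem triangleComb_isTrisection (len : J → ℕ) {n : ℕ} (h : n ∈ J ∧ n ≠ 0) :
    ∃ c t, IsTrisection (attach (triangleRay J o) (fun j : J => toothEnd J j) len) c t ∧
      ∀ x y z, (base (fun j : J => toothEnd J j) len x).1.1 < n →
        n < (base (fun j : J => toothEnd J j) len y).1.1 →
        base (fun j : J => toothEnd J j) len z = toothEnd J n →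
        ∀ i, c x = i ∨ c y = i ∨ c z = i := by
  have hside : ∀ k, side n (⟨(n, k), Or.inr h⟩ : TriangleCombVertex J) = k := by simp [side]
  have hneg : ∀ k : Fin 3, -k = -(k + 1) + 1 := by decide
  have hcolors : ∀ x y z : TriangleCombVertex J, x.1.1 < n → n < y.1.1 → z = toothEnd J n →
      side n x = 0 ∧ side n y = 1 ∧ side n z = 2 := by
    rintro x y z hx hy rfl
    exact ⟨side_of_lt hx, side_of_gt hy, by simp [side, toothEnd, h]⟩
  cases ho : o n
  -- For the reversed orientation the colours are negated, so that the triangle runs from colour `i`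
  -- to colour `i + 1`.
  · refine ⟨fun x => -side n (base (fun j : J => toothEnd J j) len x),
      fun k => Sum.inl ⟨(n, -k), Or.inr h⟩, ⟨fun k => ?_, fun {x y} hxy hne => ?_⟩,
      fun x y z hx hy hz i => ?_⟩
    · rw [base_inl, hside, neg_neg]
    · obtain ⟨p, q, rfl, rfl, hpq⟩ := attach_adj_of_base_ne hxy fun h' => hne (by rw [h'])
      simp only [base_inl] at hne
      cases hpq with
      | cycle m hm k hom =>
        obtain rfl : m = n := by
          by_contra hmn; exact hne (by simp [side, hmn])
        simp [ho] at hom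
      | cycleRev m hm k hom =>
        obtain rfl : m = n := by
          by_contra hmn; exact hne (by simp [side, hmn])
        refine ⟨-(k + 1), by rw [neg_neg], ?_⟩
        rw [← hneg k, neg_neg]
      | toRight m => exact absurd (by rw [side_rightEnd h]) hne
      | toLeft m => exact absurd (by rw [side_rightEnd h]) hne
    · obtain ⟨h0, h1, h2⟩ := hcolors _ _ _ hx hy hz
      simp only [h0, h1, h2]
      revert i; decide
  · refine ⟨fun x => side n (base (fun j : J => toothEnd J j) len x),
      fun k => Sum.inl ⟨(n, k), Or.inr h⟩, ⟨fun k => hside k, fun {x y} hxy hne => ?_⟩,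
      fun x y z hx hy hz i => ?_⟩
    · obtain ⟨p, q, rfl, rfl, hpq⟩ := attach_adj_of_base_ne hxy fun h' => hne (by rw [h'])
      simp only [base_inl] at hne
      cases hpq with
      | cycleRev m hm k hom =>
        obtain rfl : m = n := by
          by_contra hmn; exact hne (by simp [side, hmn])
        simp [ho] at hom
      | cycle m hm k hom =>
        obtain rfl : m = n := by
          by_contra hmn; exact hne (by simp [side, hmn])
        exact ⟨k, rfl, rfl⟩
      | toRight m => exact absurd (by rw [side_rightEnd h]) hne
      | toLeft m => exact absurd (by rw [side_rightEnd h]) hne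
    · obtain ⟨h0, h1, h2⟩ := hcolors _ _ _ hx hy hz
      simp only [h0, h1, h2]
      revert i; decide

end TriangleRay

/-! ### Chains of triangles -/

theorem triangleChain_reach (n : ℕ) (k : Fin 3) :
    ReachIn triangleChain.Adj {z | n ≤ z.1} (n, 0) (n, k) ∧
    ReachIn triangleChain.Adj {z | n ≤ z.1} (n, k) (n, 0) := by
  have h01 : ReachIn triangleChain.Adj {z | n ≤ z.1} (n, 0) (n, 1) := .single (.ab n) (le_refl n) (le_refl n)
  have h12 : ReachIn triangleChain.Adj {z | n ≤ z.1} (n, 1) (n, 2) := .single (.bc n) (le_refl n) (le_refl n)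
  have h20 : ReachIn triangleChain.Adj {z | n ≤ z.1} (n, 2) (n, 0) := .single (.ca n) (le_refl n) (le_refl n)
  match k with
  | 0 => exact ⟨.refl _ _ _, .refl _ _ _⟩
  | 1 => exact ⟨h01, h12.trans h20⟩
  | 2 => exact ⟨h01.trans h12, h20⟩

theorem triangleChain_reach_succ (n : ℕ) :
    ReachIn triangleChain.Adj {z | n ≤ z.1} (n, 0) (n + 1, 0) ∧
    ReachIn triangleChain.Adj {z | n ≤ z.1} (n + 1, 0) (n, 0) :=
  have hs : n ≤ n + 1 := Nat.le_succ n
  ⟨((triangleChain_reach n 2).1.trans (.single (.cc n) (le_refl n) hs)).trans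
    ((triangleChain_reach (n + 1) 2).2.subset fun _ hz => hs.trans hz),
    .single (.aa n) hs (le_refl n)⟩

theorem triangleChain_hasStrongRay : HasStrongRay triangleChain := by
  refine ⟨fun i => (i, 0), fun i j h => congrArg Prod.fst h, fun y => ⟨y.1 + 1, fun i hi => ?_⟩⟩
  have hsub : {z : ℕ × Fin 3 | i ≤ z.1} ⊆ {y}ᶜ := by
    rintro z hz rfl
    exact absurd (le_trans hi hz) (by omega)
  exact ⟨(triangleChain_reach_succ i).1.subset hsub, (triangleChain_reach_succ i).2.subset hsub⟩

theorem triangleChain_stronglyConnected : StronglyConnected triangleChain :=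
  stronglyConnected_of_sequence (fun i => (i, 0))
    (fun x => ⟨x.1, (triangleChain_reach x.1 x.2).2.reflTransGen,
      (triangleChain_reach x.1 x.2).1.reflTransGen⟩)
    fun n => ⟨(triangleChain_reach_succ n).1.reflTransGen,
      (triangleChain_reach_succ n).2.reflTransGen⟩

theorem triangleChain_hasTriangle : HasTriangle triangleChain := by
  refine ⟨fun k => (0, k), fun k l h => congrArg Prod.snd h, fun k => ?_⟩
  match k with
  | 0 => exact .ab 0
  | 1 => exact .bc 0
  | 2 => exact .ca 0

theorem IsTrisection.color_eq_of_digon {V : Type u} {D : Digraph V} {c : V → Fin 3}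
    {t : Fin 3 → V} (h : IsTrisection D c t) {x y : V} (hxy : D.Adj x y) (hyx : D.Adj y x) :
    c x = c y := by
  by_contra hne
  obtain ⟨i, rfl, rfl⟩ := h.cross hxy hne
  obtain ⟨j, hj, hj'⟩ := h.cross hyx (Ne.symm hne)
  have h1 := congrArg c hj
  have h2 := congrArg c hj'
  simp only [h.color] at h1 h2
  revert h1 h2
  clear hj hj' hne hxy hyx
  revert i j
  decide

theorem attach_adj_core_or_digon {B I : Type u} {K : Digraph B} {β : I → B} {len : I → ℕ}
    {x y : B ⊕ (Σ i : I, Fin (len i))} (h : (attach K β len).Adj x y) :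
    (attach K β len).Adj y x ∨ ∃ p q, x = Sum.inl p ∧ y = Sum.inl q ∧ K.Adj p q := by
  cases h with
  | core h => exact Or.inr ⟨_, _, rfl, rfl, h⟩
  | firstOut => exact Or.inl (.firstIn _ _)
  | firstIn => exact Or.inl (.firstOut _ _)
  | stepOut => exact Or.inl (.stepIn _ _ _)
  | stepIn => exact Or.inl (.stepOut _ _ _)

theorem mk_one_injective : Function.Injective fun i : ℕ => (i, (1 : Fin 3)) :=
  fun _ _ h => congrArg Prod.fst h

/-- Edges of the rows `a` and `c` lie on no directed triangle, so each row has a single colour. A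
trisection has only one edge between two given colours, while the triangles repeat infinitely often;
this forces the whole core, and with it the triangle `t`, into one colour. -/
theorem triangleChain_not_isTrisection (len : ℕ → ℕ)
    {c : ℕ × Fin 3 ⊕ (Σ i : ℕ, Fin (len i)) → Fin 3}
    {t : Fin 3 → ℕ × Fin 3 ⊕ (Σ i : ℕ, Fin (len i))}
    (h : IsTrisection (attach triangleChain (fun i : ℕ => (i, (1 : Fin 3))) len) c t)
    (ht : ∀ i, (attach triangleChain (fun i : ℕ => (i, (1 : Fin 3))) len).Adj (t i) (t (i + 1))) :
    False := by
  have h3 : ∀ i : Fin 3, i + 1 + 1 + 1 = i := by decide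
  -- If this edge changed colour, it would be `t k → t (k + 1)`, and `t (k + 2)` would complete a
  -- directed triangle through it.
  have haa : ∀ i, c (Sum.inl (i + 1, 0)) = c (Sum.inl (i, 0)) := by
    intro i
    by_contra hne
    obtain ⟨k, hk, hk'⟩ := h.cross (.core (.aa i)) hne
    have h1 := ht (k + 1)
    have h2 := ht (k + 1 + 1)
    rw [← hk'] at h1
    rw [h3, ← hk] at h2
    generalize t (k + 1 + 1) = z at h1 h2
    cases h2 with
    | core h2 =>
      have h1 := attach_adj_inl_iff.1 h1
      cases h2 <;> cases h1
  have hcc : ∀ i, c (Sum.inl (i, 2)) = c (Sum.inl (i + 1, 2)) := by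
    intro i
    by_contra hne
    obtain ⟨k, hk, hk'⟩ := h.cross (.core (.cc i)) hne
    have h1 := ht (k + 1)
    have h2 := ht (k + 1 + 1)
    rw [← hk'] at h1
    rw [h3, ← hk] at h2
    generalize t (k + 1 + 1) = z at h1 h2
    cases h2 with
    | core h2 =>
      have h1 := attach_adj_inl_iff.1 h1
      cases h2 <;> cases h1
  have ha : ∀ i, c (Sum.inl (i, 0)) = c (Sum.inl (0, 0)) := fun i => by
    induction i with
    | zero => rfl
    | succ i ih => rw [haa, ih]
  have hc : ∀ i, c (Sum.inl (i, 2)) = c (Sum.inl (0, 2)) := fun i => by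
    induction i with
    | zero => rfl
    | succ i ih => rw [← hcc, ih]
  -- Otherwise `c 0 → a 0` and `c 1 → a 1` would both be the unique edge of the trisection between
  -- their two colours.
  have hca : c (Sum.inl (0, 2)) = c (Sum.inl (0, 0)) := by
    by_contra hne
    obtain ⟨k, hk, -⟩ := h.cross (.core (.ca 0)) hne
    obtain ⟨l, hl, -⟩ := h.cross (.core (.ca 1)) (by rwa [ha, hc])
    have := hc 1
    rw [hk, hl, h.color, h.color] at this
    rw [this, ← hk] at hl
    simp at hl
  -- Otherwise both `a i` and `c i` would be the vertex of `t` of their common colour.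
  have hb : ∀ i, c (Sum.inl (i, 1)) = c (Sum.inl (0, 0)) := by
    intro i
    by_contra hne
    obtain ⟨k, hk, -⟩ := h.cross (.core (.ab i)) (by rw [ha]; exact Ne.symm hne)
    obtain ⟨l, -, hl⟩ := h.cross (.core (.bc i)) (by rw [hc, hca]; exact hne)
    have := (hc i).trans (hca.trans (ha i).symm)
    rw [hk, hl, h.color, h.color] at this
    rw [this, ← hk] at hl
    simp at hl
  have hcore : ∀ p, c (Sum.inl p) = c (Sum.inl (0, 0)) := by
    rintro ⟨i, k⟩
    match k with
    | 0 => exact ha i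
    | 1 => exact hb i
    | 2 => exact (hc i).trans hca
  have : c (t 0) = c (t (0 + 1)) := by
    rcases attach_adj_core_or_digon (ht 0) with h' | ⟨p, q, hp, hq, -⟩
    · exact h.color_eq_of_digon (ht 0) h'
    · rw [hp, hq, hcore p, hcore q]
  rw [h.color, h.color] at this
  exact absurd this (by decide)

/-! ### Further distinguishing properties and tails of rays -/

/-- There are a vertex of infinite in-degree or of infinite out-degree and, in the underlying
undirected graph, a ray avoiding it. -/
def HasDominatedRay {V : Type u} (D : Digraph V) : Prop :=
  ∃ (r : V) (v : ℕ → V), Function.Injective v ∧ (∀ i, v i ≠ r) ∧ (∀ i, WeakAdj D (v i) (v (i + 1))) ∧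
    ({z | D.Adj z r}.Infinite ∨ {z | D.Adj r z}.Infinite)

/-- There is a vertex of infinite in-degree and infinite out-degree. -/
def HasInfiniteStar {V : Type u} (D : Digraph V) : Prop :=
  ∃ c : V, {z | D.Adj z c}.Infinite ∧ {z | D.Adj c z}.Infinite

/-- The vertices can be partitioned into three classes joined only by the edges of a directed
cycle of length three. -/
def HasCyclicTrisection {V : Type u} (D : Digraph V) : Prop :=
  ∃ c t, IsTrisection D c t ∧ ∀ i, D.Adj (t i) (t (i + 1))

theorem HasCyclicTrisection.hasTriangle {V : Type u} {D : Digraph V}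
    (h : HasCyclicTrisection D) : HasTriangle D := by
  obtain ⟨c, t, h, ht⟩ := h
  exact ⟨t, fun i j hij => by rw [← h.color i, hij, h.color], ht⟩

theorem ReachIn.left_mem {V : Type u} {R : V → V → Prop} {A : Set V} {x y : V}
    (h : ReachIn R A x y) (hne : x ≠ y) : x ∈ A := by
  obtain ⟨p, hp, -, -, hpA, -⟩ := h.crossing (S := {x}) rfl hne.symm
  exact Set.mem_singleton_iff.1 hp ▸ hpA

theorem reachIn_of_le {V : Type u} {R : V → V → Prop} {A : Set V} {v : ℕ → V} {N : ℕ}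
    (h : ∀ i ≥ N, ReachIn R A (v i) (v (i + 1))) {j : ℕ} (hj : N ≤ j) :
    ReachIn R A (v N) (v j) := by
  induction j, hj using Nat.le_induction with
  | base => exact .refl _ _ _
  | succ n hn ih => exact ih.trans (h n hn)

theorem reachIn_of_ge {V : Type u} {R : V → V → Prop} {A : Set V} {v : ℕ → V} {N : ℕ}
    (h : ∀ i ≥ N, ReachIn R A (v (i + 1)) (v i)) {j : ℕ} (hj : N ≤ j) :
    ReachIn R A (v j) (v N) := by
  induction j, hj using Nat.le_induction with
  | base => exact .refl _ _ _
  | succ n hn ih => exact (h n hn).trans ih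

theorem HasDominatedRay.hasWeakRay {V : Type u} {D : Digraph V} (h : HasDominatedRay D) :
    HasWeakRay D := by
  obtain ⟨r, v, hv, -, hadj, -⟩ := h
  refine ⟨v, hv, fun y => ?_⟩
  have : ∃ N, ∀ i ≥ N, v i ≠ y := by
    by_cases h : ∃ n, v n = y
    · obtain ⟨n, rfl⟩ := h
      exact ⟨n + 1, fun i hi h => by have := hv h; omega⟩
    · exact ⟨0, fun i _ h' => h ⟨i, h'⟩⟩
  obtain ⟨N, hN⟩ := this
  exact ⟨N, fun i hi => .single (hadj i) (hN i hi) (hN (i + 1) (hi.trans (Nat.le_succ i)))⟩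

theorem infinite_of_injective_tail {V : Type u} {f : ℕ → V} (hf : Function.Injective f) (N : ℕ)
    {S : Set V} (h : ∀ j ≥ N, f j ∈ S) : S.Infinite :=
  ((Set.Ici_infinite N).image hf.injOn).mono (by rintro _ ⟨j, hj, rfl⟩; exact h j hj)

section Exclusion

variable {W : Type v} {V : Type u} {H : Digraph W} {D : Digraph V}

namespace TreeLikeModel

/-- At most one branch set contains `x`; deleting its vertex `y` from the minor makes all lifted
walks avoid `x`. -/
theorem exists_notMem_cover_compl [Nonempty W] (μ : TreeLikeModel H D) (x : V) :
    ∃ y, x ∉ μ.cover {y}ᶜ := by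
  by_cases h : ∃ y, x ∈ μ.branch y
  · obtain ⟨y, hy⟩ := h
    refine ⟨y, fun h' => ?_⟩
    obtain ⟨z, hz, hxz⟩ := μ.mem_cover.1 h'
    exact hz (μ.eq_of_mem_branch hxz hy)
  · obtain ⟨y⟩ := ‹Nonempty W›
    refine ⟨y, fun h' => ?_⟩
    obtain ⟨z, -, hxz⟩ := μ.mem_cover.1 h'
    exact h ⟨z, hxz⟩

theorem exists_root_notMem (μ : TreeLikeModel H D) [Infinite W] {Q : Set V} (hQ : Q.Finite) :
    ∃ z, μ.root z ∉ Q := by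
  by_contra! h
  exact Set.infinite_univ (hQ.preimage μ.root_injective.injOn |>.subset fun z _ => h z)

end TreeLikeModel

/-! ### Minors of subdivided stars -/

/-- After deletion of the vertex whose branch set contains the centre, the lifts of a tail of the
ray stay in one pendant path, which is finite. -/
theorem not_hasWeakRay_of_vertexStar {I : Type u} {len : I → ℕ}
    (μ : TreeLikeModel H (attach single.{u} (fun _ : I => PUnit.unit) len)) :
    ¬ HasWeakRay H := by
  rintro ⟨v, hv, h⟩
  have : Nonempty W := ⟨v 0⟩
  obtain ⟨y, hy⟩ := μ.exists_notMem_cover_compl (Sum.inl PUnit.unit)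
  obtain ⟨N, hN⟩ := h y
  have hreach : ∀ j ≥ N, ReachIn _ _ _ _ := fun j hj => μ.reachIn_weak_cover (reachIn_of_le hN hj)
  have hNy : v N ∈ ({y}ᶜ : Set W) := (hN N le_rfl).left_mem fun h => by
    have := hv h; omega
  obtain ⟨i, hi⟩ : ∃ i, μ.root (v N) ∈ pendant len i := by
    rcases hr : μ.root (v N) with ⟨⟩ | ⟨i, k⟩
    · exact absurd (μ.branch_subset_cover hNy (hr ▸ μ.root_mem (v N))) hy
    · exact ⟨i, k, rfl⟩
  refine infinite_of_injective_tail (μ.root_injective.comp hv) N (S := pendant len i) (fun j hj => ?_)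
    (pendant_finite len i)
  by_contra hj'
  obtain ⟨p, hp, q, hq, -, hqA, hpq⟩ := (hreach j hj).crossing hi hj'
  rw [eq_of_weakAdj_pendant hpq hp hq] at hqA
  exact hy hqA

/-! ### Minors of dominated directed rays with attached double paths -/

theorem rayStar_adj_cases {len : ℕ → ℕ} {x y : ℕ ⊕ (Σ i : ℕ, Fin (len i))}
    (h : (attach dominatedOutRay id len).Adj x y) :
    base id len x = base id len y ∨ (y = Sum.inl (base id len x + 1)) ∨ y = Sum.inl 0 := by
  rcases attach_adj_cases h with h | ⟨p, q, rfl, rfl, h | h⟩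
  · exact Or.inl h
  · exact Or.inr (Or.inl (by rw [h]; rfl))
  · exact Or.inr (Or.inr (by rw [h.2]))

theorem base_le_of_reachIn {len : ℕ → ℕ} {A : Set (ℕ ⊕ (Σ i : ℕ, Fin (len i)))}
    (hA : Sum.inl 0 ∉ A) {x y} (h : ReachIn (attach dominatedOutRay id len).Adj A x y) :
    base id len x ≤ base id len y := by
  induction h with
  | refl => exact le_rfl
  | tail _ h ih =>
    rcases rayStar_adj_cases h.1 with h' | h' | h'
    · exact ih.trans h'.le
    · rw [h']; exact ih.trans (Nat.le_succ _)
    · exact absurd (h' ▸ h.2.2) hA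

/-- Away from the root `0`, walks never decrease `base`. The roots of a tail of the ray are mutually
reachable there, so they all share one value of `base`, leaving only finitely many vertices. -/
theorem not_hasStrongRay_of_rayStar {len : ℕ → ℕ}
    (μ : TreeLikeModel H (attach dominatedOutRay id len)) : ¬ HasStrongRay H := by
  rintro ⟨v, hv, h⟩
  have : Nonempty W := ⟨v 0⟩
  obtain ⟨y, hy⟩ := μ.exists_notMem_cover_compl (Sum.inl 0)
  obtain ⟨N, hN⟩ := h y
  refine infinite_of_injective_tail (μ.root_injective.comp hv) N
    (S := base id len ⁻¹' {base id len (μ.root (v N))}) (fun j hj => ?_)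
    (finite_base_preimage id len Function.injective_id (Set.finite_singleton _))
  exact le_antisymm
    (base_le_of_reachIn hy (μ.reachIn_cover (reachIn_of_ge (fun i hi => (hN i hi).2) hj)))
    (base_le_of_reachIn hy (μ.reachIn_cover (reachIn_of_le (fun i hi => (hN i hi).1) hj)))

theorem finite_out_of_rayStar {len : ℕ → ℕ} (p : ℕ ⊕ (Σ i : ℕ, Fin (len i))) :
    {q | (attach dominatedOutRay id len).Adj p q}.Finite := by
  refine (finite_base_preimage id len Function.injective_id
    (Set.finite_Iic (base id len p + 1))).subset fun q hq => ?_
  change base id len q ≤ base id len p + 1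
  rcases rayStar_adj_cases hq with h | h | h
  · exact h.ge.trans (Nat.le_succ _)
  · rw [h]; exact le_rfl
  · rw [h]; exact Nat.zero_le _

/-- An infinite out-arborescence climbs the ray and thus occupies a vertex `n` of the ray beyond the
root of `c`. A branch set rooted over `n` would then be rooted on the pendant path at `n`, whose
only exit is blocked for walks back to `c`. -/
theorem not_infinite_out_of_rayStar {len : ℕ → ℕ}
    (μ : TreeLikeModel H (attach dominatedOutRay id len)) (hH : StronglyConnected H) (c : W) :
    ¬ {z | H.Adj c z}.Infinite := by
  intro hc
  have : Infinite W := Set.infinite_univ_iff.1 (hc.mono (Set.subset_univ _))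
  have hfin : ∀ n, (base id len ⁻¹' Set.Iic n).Finite := fun n =>
    finite_base_preimage id len Function.injective_id (Set.finite_Iic n)
  obtain ⟨z, hz⟩ := μ.exists_root_notMem (hfin (base id len (μ.root c)))
  set n := base id len (μ.root z) with hn
  have hlt : base id len (μ.root c) < n := not_le.1 hz
  have hmem : Sum.inl n ∈ (μ.outTree c).verts := by
    obtain ⟨p, hp, hpn⟩ := (μ.outTree_infinite finite_out_of_rayStar hc).exists_notMem_finite
      (hfin n)
    have hpn : n < base id len p := not_le.1 hpn
    obtain ⟨a, ha, b, hb, -, hbO, hab⟩ := (μ.reachIn_out hp).crossing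
      (S := {x | base id len x < n}) hlt (not_lt.2 hpn.le)
    have ha : base id len a < n := ha
    have hb : n ≤ base id len b := not_lt.1 hb
    rcases rayStar_adj_cases hab with h | h | h
    · omega
    · rw [h, base_inl] at hb
      rwa [h, show base id len a + 1 = n by omega] at hbO
    · rw [h, base_inl] at hb
      omega
  -- A vertex of the out-arborescence that also lies on the entering side would be the root of `c`,
  -- whose `base` is smaller than `n`.
  have hnot : Sum.inl n ∉ μ.inSide Set.univ c := fun h => by
    have := μ.eq_root (μ.mem_in_of_mem_inSide h (Or.inr hmem)) hmem
    rw [← this, base_inl] at hlt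
    exact lt_irrefl _ hlt
  have hzP : μ.root z ∈ pendant len n := by
    rcases hr : μ.root z with m | ⟨i, k⟩
    · rw [hr, base_inl] at hn
      have : z = c := μ.eq_of_mem_branch (μ.root_mem z) (by rw [hr, ← hn]; exact Or.inr hmem)
      rw [hn, ← this, hr, base_inl] at hlt
      exact absurd hlt (lt_irrefl _)
    · rw [hr, base_inr] at hn
      rw [show n = i from hn]
      exact ⟨k, rfl⟩
  have hcP : μ.root c ∉ pendant len n := by
    rintro ⟨k, hk⟩
    rw [← hk, base_inr] at hlt
    exact lt_irrefl _ hlt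
  obtain ⟨p, hp, q, hq, -, hqA, hpq⟩ :=
    (μ.reachIn_inSide (reachIn_univ (hH z c))).crossing hzP hcP
  rw [eq_of_weakAdj_pendant (Or.inl hpq) hp hq] at hqA
  exact hnot hqA

/-- Walks from and to `x` both pass through the attachment vertex `β i`, whose branch set belongs to
some `y`. This `y` separates `x` from every other vertex rooted outside the pendant path. -/
theorem not_weaklyTwoConnected_of_root_mem_pendant {B I : Type u} {K : Digraph B} {β : I → B}
    {len : I → ℕ} (μ : TreeLikeModel H (attach K β len)) (hH : StronglyConnected H) {x : W} {i : I}
    (hx : μ.root x ∈ pendant len i) : ¬ WeaklyTwoConnected H := by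
  rintro ⟨_, h⟩
  obtain ⟨z, hz⟩ := μ.exists_root_notMem (pendant_finite len i)
  obtain ⟨p, hp, q, hq, -, hqA, hpq⟩ :=
    (μ.reachIn_outSide (reachIn_univ (hH x z))).crossing hx hz
  rw [eq_of_weakAdj_pendant (Or.inl hpq) hp hq] at hqA
  obtain ⟨q', hq', p', hp', hqA', -, hpq'⟩ :=
    (μ.reachIn_inSide (reachIn_univ (hH z x))).crossing (S := (pendant len i)ᶜ) hz
      (not_not.2 hx)
  rw [eq_of_weakAdj_pendant (Or.inr hpq') (not_not.1 hp') hq'] at hqA'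
  obtain ⟨y, -, hy⟩ := μ.mem_cover.1 (μ.mem_cover_of_mem_inSide hqA')
  -- If `β i` were in the branch set of `x`, it would lie in both arborescences and be the root,
  -- which is on the pendant path.
  have hyx : y ≠ x := by
    rintro rfl
    have := μ.eq_root (μ.mem_in_of_mem_inSide hqA' hy) (μ.mem_out_of_mem_outSide hqA hy)
    rw [← this] at hx
    obtain ⟨k, hk⟩ := hx
    exact Sum.inr_ne_inl hk
  obtain ⟨w, hw⟩ := μ.exists_root_notMem ((pendant_finite len i).insert (μ.root y))
  rw [Set.mem_insert_iff, not_or] at hw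
  obtain ⟨a, ha, b, hb, -, hbA, hab⟩ := (μ.reachIn_weak_cover
    (h y x w hyx.symm fun h => hw.1 (h ▸ rfl))).crossing hx hw.2
  rw [eq_of_weakAdj_pendant hab ha hb] at hbA
  obtain ⟨y', hy', hb'⟩ := μ.mem_cover.1 hbA
  exact hy' (μ.eq_of_mem_branch hb' hy)

/-- One of the two directions of a digon goes backwards along the ray, so the branch sets of its two
vertices cover `0`. Two disjoint digons cannot both do so. -/
theorem not_hasDisjointDigons_of_dominatedOutRay (μ : TreeLikeModel H dominatedOutRay) :
    ¬ HasDisjointDigons H := by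
  have key' : ∀ A : Set ℕ, ∀ m n : ℕ, m < n → ReachIn dominatedOutRay.Adj A n m → 0 ∈ A := by
    intro A m n hmn h
    obtain ⟨p, hp, q, hq, -, hqA, hpq⟩ := h.crossing (S := Set.Ioi m) hmn (lt_irrefl m)
    have hp : m < p := hp
    have hq : q ≤ m := not_lt.1 hq
    rcases hpq with hpq | hpq
    · omega
    · rwa [hpq.2] at hqA
  have key : ∀ x y, x ≠ y → H.Adj x y → H.Adj y x → 0 ∈ μ.cover {x, y} := by
    intro x y hne hxy hyx
    rcases lt_or_gt_of_ne (μ.root_injective.ne hne) with h | h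
    · exact key' _ _ _ h (μ.reachIn_cover_step hyx (by simp) (by simp))
    · exact key' _ _ _ h (μ.reachIn_cover_step hxy (by simp) (by simp))
  rintro ⟨x, y, x', y', hne, hne', hdisj, hxy, hyx, hxy', hyx'⟩
  obtain ⟨z, hz, h⟩ := μ.mem_cover.1 (key x y hne hxy hyx)
  obtain ⟨z', hz', h'⟩ := μ.mem_cover.1 (key x' y' hne' hxy' hyx')
  obtain rfl := μ.eq_of_mem_branch h h'
  exact Set.disjoint_left.1 hdisj hz hz'

/-! ### Minors of digraphs exhausted by cut vertices -/

theorem CutVertexExhausted.finite_weakAdj (hD : CutVertexExhausted D) (p : V) :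
    {q | WeakAdj D p q}.Finite := by
  obtain ⟨S, hS, hpS, s, -, hsp, h⟩ := hD {p} (Set.finite_singleton p)
  refine hS.subset fun q hq => ?_
  by_contra hqS
  exact hsp (h p (hpS rfl) q hqS hq).symm

/-- Both sets are connected, start in the finite set `S` and leave it; hence both contain its only
boundary vertex `s`. -/
theorem CutVertexExhausted.exists_mem_inter (hD : CutVertexExhausted D) {A B F : Set V} {a b : V}
    (hA : A.Infinite) (hB : B.Infinite) (hA' : ∀ x ∈ A, ReachIn (WeakAdj D) A a x)
    (hB' : ∀ x ∈ B, ReachIn (WeakAdj D) B b x) (hF : F.Finite) : ∃ s ∈ A, s ∈ B ∧ s ∉ F := by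
  obtain ⟨S, hS, hFS, s, -, hsF, h⟩ := hD (insert a (insert b F)) ((hF.insert b).insert a)
  have key : ∀ (A : Set V) (a : V), A.Infinite → (∀ x ∈ A, ReachIn (WeakAdj D) A a x) → a ∈ S →
      s ∈ A := by
    intro A a hA hA' ha
    obtain ⟨x, hx, hxS⟩ := hA.exists_notMem_finite hS
    obtain ⟨p, hp, q, hq, hpA, -, hpq⟩ := (hA' x hx).crossing ha hxS
    exact h p hp q hq hpq ▸ hpA
  exact ⟨s, key A a hA hA' (hFS (by simp)), key B b hB hB' (hFS (by simp)),
    fun h => hsF (by simp [h])⟩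

/-- The in- and out-arborescence of the centre would be infinite, hence meet outside the root. -/
theorem CutVertexExhausted.not_hasInfiniteStar (hD : CutVertexExhausted D)
    (μ : TreeLikeModel H D) : ¬ HasInfiniteStar H := by
  rintro ⟨c, hin, hout⟩
  obtain ⟨s, hs, hs', hne⟩ := hD.exists_mem_inter (F := {μ.root c})
    (μ.inTree_infinite (fun p => (hD.finite_weakAdj p).subset fun _ h => Or.inr h) hin)
    (μ.outTree_infinite (fun p => (hD.finite_weakAdj p).subset fun _ h => Or.inl h) hout)
    (fun x hx => (μ.reachIn_in hx).weak.weak_symm) (fun x hx => (μ.reachIn_out hx).weak)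
    (Set.finite_singleton _)
  exact hne (μ.eq_root hs hs')

/-- An infinite arborescence of `r` would meet the branch sets of the ray, which form an infinite
connected set disjoint from it. -/
theorem CutVertexExhausted.not_hasDominatedRay (hD : CutVertexExhausted D)
    (μ : TreeLikeModel H D) : ¬ HasDominatedRay H := by
  rintro ⟨r, v, hv, hvr, hadj, hr⟩
  have hB : (μ.cover (Set.range v)).Infinite :=
    infinite_of_injective_tail (μ.root_injective.comp hv) 0
      fun j _ => μ.branch_subset_cover (Set.mem_range_self j) (μ.root_mem (v j))
  have hB' : ∀ x ∈ μ.cover (Set.range v),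
      ReachIn (WeakAdj D) (μ.cover (Set.range v)) (μ.root (v 0)) x := by
    intro x hx
    obtain ⟨_, ⟨i, rfl⟩, hx⟩ := μ.mem_cover.1 hx
    exact (μ.reachIn_weak_cover (reachIn_of_le
      (fun i _ => .single (hadj i) (Set.mem_range_self i) (Set.mem_range_self (i + 1))) (Nat.zero_le i))).trans
      ((μ.reachIn_weak_root hx).weak_symm.subset (μ.branch_subset_cover (Set.mem_range_self i)))
  have : ∃ s ∈ μ.branch r, s ∈ μ.cover (Set.range v) := by
    rcases hr with hr | hr
    · obtain ⟨s, hs, hs', -⟩ := hD.exists_mem_inter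
        (μ.inTree_infinite (fun p => (hD.finite_weakAdj p).subset fun _ h => Or.inr h) hr) hB
        (fun x hx => (μ.reachIn_in hx).weak.weak_symm) hB' Set.finite_empty
      exact ⟨s, Or.inl hs, hs'⟩
    · obtain ⟨s, hs, hs', -⟩ := hD.exists_mem_inter
        (μ.outTree_infinite (fun p => (hD.finite_weakAdj p).subset fun _ h => Or.inl h) hr) hB
        (fun x hx => (μ.reachIn_out hx).weak) hB' Set.finite_empty
      exact ⟨s, Or.inr hs, hs'⟩
  obtain ⟨s, hs, hs'⟩ := this
  obtain ⟨_, ⟨i, rfl⟩, hs'⟩ := μ.mem_cover.1 hs'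
  exact hvr i (μ.eq_of_mem_branch hs' hs)

/-! ### Directed triangles in minors of combs -/

/-- The bridge used by the edge from `t 0` to `t 1` has its ends in these two branch sets, so it
separates them. The detour through `t 2` would have to cross the same bridge a second time. -/
theorem AllBridges.not_hasTriangle (hD : AllBridges D) (μ : TreeLikeModel H D) :
    ¬ HasTriangle H := by
  rintro ⟨t, ht, h⟩
  have h01 : H.Adj (t 0) (t 1) := h 0
  have h12 : H.Adj (t 1) (t 2) := h 1
  have h20 : H.Adj (t 2) (t 0) := h 2
  obtain ⟨S, hp, hq, hS⟩ := hD _ _ (μ.edge_adj h01)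
  have hp0 := μ.out_subset _ (μ.edgeTail_mem h01)
  have hq1 := μ.in_subset _ (μ.edgeHead_mem h01)
  have h0S : ∀ x ∈ μ.branch (t 0), x ∈ S := by
    intro x hx
    by_contra hxS
    obtain ⟨a, ha, b, hb, -, hb', hab⟩ := μ.branch_crossing hp0 hx hp hxS
    rw [(hS a ha b hb hab).2] at hb'
    exact absurd (ht (μ.eq_of_mem_branch hb' hq1)) (by decide)
  have h1S : ∀ x ∈ μ.branch (t 1), x ∉ S := by
    intro x hx hxS
    obtain ⟨a, ha, b, hb, ha', -, hab⟩ := μ.branch_crossing hx hq1 hxS hq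
    rw [(hS a ha b hb hab).1] at ha'
    exact absurd (ht (μ.eq_of_mem_branch ha' hp0)) (by decide)
  have hp12 := μ.out_subset _ (μ.edgeTail_mem h12)
  have hq12 := μ.in_subset _ (μ.edgeHead_mem h12)
  have hp20 := μ.out_subset _ (μ.edgeTail_mem h20)
  have hq20 := μ.in_subset _ (μ.edgeHead_mem h20)
  by_cases h2 : μ.edgeHead h12 ∈ S
  · have := (hS _ h2 _ (h1S _ hp12) (Or.inr (μ.edge_adj h12))).1
    rw [this] at hq12
    exact absurd (ht (μ.eq_of_mem_branch hq12 hp0)) (by decide)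
  by_cases h2' : μ.edgeTail h20 ∈ S
  · obtain ⟨a, ha, b, hb, ha', -, hab⟩ := μ.branch_crossing hp20 hq12 h2' h2
    rw [(hS a ha b hb hab).1] at ha'
    exact absurd (ht (μ.eq_of_mem_branch ha' hp0)) (by decide)
  · have := (hS _ (h0S _ hq20) _ h2' (Or.inr (μ.edge_adj h20))).2
    rw [this] at hp20
    exact absurd (ht (μ.eq_of_mem_branch hp20 hq1)) (by decide)

/-! ### Trisections of minors -/

theorem IsTrisection.leaving {c : V → Fin 3} {t : Fin 3 → V} (h : IsTrisection D c t) {A : Set V}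
    {x y : V} (hxy : ReachIn D.Adj A x y) (hne : c x ≠ c y) : t (c x) ∈ A ∧ t (c x + 1) ∈ A := by
  obtain ⟨p, hp, q, hq, hpA, hqA, hpq⟩ := hxy.crossing (S := {z | c z = c x}) rfl (Ne.symm hne)
  have hp : c p = c x := hp
  obtain ⟨i, rfl, rfl⟩ := h.cross hpq fun h => hq (h.symm.trans hp)
  rw [h.color] at hp
  exact hp ▸ ⟨hpA, hqA⟩

theorem IsTrisection.entering {c : V → Fin 3} {t : Fin 3 → V} (h : IsTrisection D c t) {A : Set V}
    {x y : V} (hxy : ReachIn D.Adj A x y) (hne : c x ≠ c y) : t (c y) ∈ A := by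
  obtain ⟨p, hp, q, hq, hpA, hqA, hpq⟩ := hxy.crossing (S := {z | c z ≠ c y}) hne (not_not.2 rfl)
  have hq : c q = c y := not_not.1 hq
  obtain ⟨i, rfl, rfl⟩ := h.cross hpq fun h => hp (h.trans hq)
  rw [h.color] at hq
  exact hq ▸ hqA

/-- When every colour contains a root, each `t k` can lie in a branch set only as its root. Thus no
branch set contains two of the `t k`, every branch set has one colour, and the trisection passes to
the minor. -/
theorem IsTrisection.hasCyclicTrisection {c : V → Fin 3} {t : Fin 3 → V} (h : IsTrisection D c t)
    (μ : TreeLikeModel H D) (hH : StronglyConnected H) (hc : ∀ i, ∃ u, c (μ.root u) = i) :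
    HasCyclicTrisection H := by
  have hfin : ∀ i k : Fin 3, k = i ∨ k = i + 1 ∨ k = i + 1 + 1 := by decide
  have hne1 : ∀ i : Fin 3, i + 1 ≠ i := by decide
  have hne2 : ∀ i : Fin 3, i ≠ i + 1 + 1 := by decide
  -- With `i` the colour of `w`, a walk to `w` from colour `i + 1` and a walk from `w` to colour `i
  -- + 2` each go through all three `t k`.
  have hroot : ∀ w k, t k ∈ μ.branch w → t k = μ.root w := by
    intro w k hk
    obtain ⟨u, hu⟩ := hc (c (μ.root w) + 1)
    obtain ⟨u', hu'⟩ := hc (c (μ.root w) + 1 + 1)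
    have hr := μ.reachIn_inSide (reachIn_univ (hH u w))
    have hr' := μ.reachIn_outSide (reachIn_univ (hH w u'))
    have hin : t k ∈ μ.inSide Set.univ w := by
      have hne : c (μ.root u) ≠ c (μ.root w) := by rw [hu]; exact hne1 _
      have h1 := h.leaving hr hne
      have h2 := h.entering hr hne
      rw [hu] at h1
      rcases hfin (c (μ.root w)) k with rfl | rfl | rfl
      exacts [h2, h1.1, h1.2]
    have hout : t k ∈ μ.outSide Set.univ w := by
      have hne : c (μ.root w) ≠ c (μ.root u') := by rw [hu']; exact hne2 _
      have h1 := h.leaving hr' hne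
      have h2 := h.entering hr' hne
      rw [hu'] at h2
      rcases hfin (c (μ.root w)) k with rfl | rfl | rfl
      exacts [h1.1, h1.2, h2]
    exact μ.eq_root (μ.mem_in_of_mem_inSide hin hk) (μ.mem_out_of_mem_outSide hout hk)
  have hunique : ∀ w k l, t k ∈ μ.branch w → t l ∈ μ.branch w → k = l := fun w k l hk hl => by
    rw [← h.color k, hroot w k hk, ← hroot w l hl, h.color]
  have hmono : ∀ w, ∀ x ∈ μ.branch w, c x = c (μ.root w) := by
    intro w x hx
    by_contra hne
    obtain ⟨p, hp, q, hq, hpw, hqw, hpq⟩ := μ.branch_crossing hx (μ.root_mem w)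
      (S := {z | c z = c x}) rfl (Ne.symm hne)
    have hp : c p = c x := hp
    rcases hpq with hpq | hpq
    · obtain ⟨i, rfl, rfl⟩ := h.cross hpq fun h => hq (h.symm.trans hp)
      exact hne1 i (hunique w _ _ hqw hpw)
    · obtain ⟨i, rfl, rfl⟩ := h.cross hpq fun h => hq (h.trans hp)
      exact hne1 i (hunique w _ _ hpw hqw)
  have hτ : ∀ i, ∃ w, t i ∈ μ.branch w := by
    intro i
    obtain ⟨u, hu⟩ := hc i
    obtain ⟨u', hu'⟩ := hc (i + 1)
    have := (h.leaving (μ.reachIn_cover (reachIn_univ (hH u u')))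
      (by rw [hu, hu']; exact (hne1 i).symm)).1
    rw [hu] at this
    obtain ⟨w, -, hw⟩ := μ.mem_cover.1 this
    exact ⟨w, hw⟩
  choose τ hτ using hτ
  have htri : IsTrisection H (fun w => c (μ.root w)) τ := by
    refine ⟨fun i => ?_, fun {x y} hxy hne => ?_⟩
    · rw [← hmono _ _ (hτ i), h.color]
    · have hp := μ.out_subset _ (μ.edgeTail_mem hxy)
      have hq := μ.in_subset _ (μ.edgeHead_mem hxy)
      obtain ⟨i, hi, hi'⟩ := h.cross (μ.edge_adj hxy) (by rwa [hmono _ _ hp, hmono _ _ hq])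
      rw [hi] at hp
      rw [hi'] at hq
      exact ⟨i, μ.eq_of_mem_branch hp (hτ i), μ.eq_of_mem_branch hq (hτ (i + 1))⟩
  -- Strong connectedness yields an edge of the minor leaving colour `i`; it can only be the one
  -- from `τ i` to `τ (i + 1)`.
  refine ⟨_, τ, htri, fun i => ?_⟩
  obtain ⟨u, hu⟩ := hc i
  obtain ⟨u', hu'⟩ := hc (i + 1)
  obtain ⟨x, hx, y, hy, -, -, hxy⟩ := (reachIn_univ (hH u u')).crossing
    (S := {w | c (μ.root w) = i}) hu (fun h' : c (μ.root u') = i => hne1 i (hu'.symm.trans h'))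
  have hx : c (μ.root x) = i := hx
  obtain ⟨j, rfl, rfl⟩ := htri.cross hxy fun h' => hy (h'.symm.trans hx)
  have := htri.color j
  rw [hx] at this
  exact this ▸ hxy

theorem infinite_setOf_root_eq_lastVertex {B I : Type u} {K : Digraph B} {β : I → B} {len : I → ℕ}
    (μ : TreeLikeModel H (attach K β len))
    (h : (Set.range (lastVertex β len) ∩ Set.range μ.root).Infinite) :
    {i | ∃ w, μ.root w = lastVertex β len i}.Infinite := by
  intro hfin
  refine h ((hfin.image (lastVertex β len)).subset ?_)
  rintro _ ⟨⟨i, rfl⟩, w, hw⟩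
  exact ⟨i, ⟨w, hw⟩, rfl⟩

/-- Among three teeth in the minor, the triangle at the middle one places them in three different
colours. The middle index is nonzero because a smaller one exists, so it does carry a triangle. -/
theorem hasCyclicTrisection_of_triangleComb {J : Set ℕ} [DecidablePred (· ∈ J)] {o : ℕ → Bool}
    {len : J → ℕ}
    (μ : TreeLikeModel H (attach (triangleRay J o) (fun j : J => toothEnd J j) len))
    (hH : StronglyConnected H)
    (h : (Set.range (lastVertex (fun j : J => toothEnd J j) len) ∩ Set.range μ.root).Infinite) :
    HasCyclicTrisection H := by
  have hinf := (infinite_setOf_root_eq_lastVertex μ h).image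
    (Subtype.val_injective (p := (· ∈ J))).injOn
  obtain ⟨_, ⟨l, ⟨x, hx⟩, rfl⟩⟩ := hinf.nonempty
  obtain ⟨_, ⟨n, ⟨z, hz⟩, rfl⟩, hln⟩ := hinf.exists_gt l
  obtain ⟨_, ⟨m, ⟨y, hy⟩, rfl⟩, hnm⟩ := hinf.exists_gt n
  have hbase : ∀ {w} {k : J}, μ.root w = lastVertex (fun j : J => toothEnd J j) len k →
      base (fun j : J => toothEnd J j) len (μ.root w) = toothEnd J k := by
    intro w k hw; rw [hw, base_lastVertex]
  obtain ⟨c, t, htri, hcol⟩ := triangleComb_isTrisection (o := o) len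
    (⟨n.2, by omega⟩ : (n : ℕ) ∈ J ∧ (n : ℕ) ≠ 0)
  refine htri.hasCyclicTrisection μ hH fun i => ?_
  rcases hcol (μ.root x) (μ.root y) (μ.root z) (by rw [hbase hx, toothEnd_fst]; exact hln)
    (by rw [hbase hy, toothEnd_fst]; exact hnm) (hbase hz) i with h | h | h
  exacts [⟨_, h⟩, ⟨_, h⟩, ⟨_, h⟩]

end Exclusion

/-! ### Minors of chains of triangles -/

section Chain

variable {W : Type v} {H : Digraph W} {len : ℕ → ℕ}

/-- The index of the triangle to which a vertex of a chain of triangles belongs or is attached. -/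
abbrev level (len : ℕ → ℕ) (x : ℕ × Fin 3 ⊕ (Σ i : ℕ, Fin (len i))) : ℕ :=
  (base (fun i : ℕ => (i, (1 : Fin 3))) len x).1

/-- The digraph consisting of a chain of triangles with attached double paths. -/
abbrev chain (len : ℕ → ℕ) : Digraph (ℕ × Fin 3 ⊕ (Σ i : ℕ, Fin (len i))) :=
  attach triangleChain (fun i : ℕ => (i, (1 : Fin 3))) len

/-- The vertices of the double path to the `i`-th tooth. -/
def toothPath (len : ℕ → ℕ) (i : ℕ) : Set (ℕ × Fin 3 ⊕ (Σ i : ℕ, Fin (len i))) :=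
  {x | base (fun i : ℕ => (i, (1 : Fin 3))) len x = (i, 1)}

variable {A : Set (ℕ × Fin 3 ⊕ (Σ i : ℕ, Fin (len i)))}
  {x y : ℕ × Fin 3 ⊕ (Σ i : ℕ, Fin (len i))} {k i : ℕ}

theorem level_of_mem_toothPath (h : x ∈ toothPath len i) : level len x = i := congrArg Prod.fst h

/-- The only edge from levels at most `k` to higher levels is `c k → c (k + 1)`; dually,
`chain_descend` uses `a (k + 1) → a k`. -/
theorem chain_ascend (h : ReachIn (chain len).Adj A x y) (hx : level len x ≤ k)
    (hy : k < level len y) : Sum.inl (k, 2) ∈ A ∧ Sum.inl (k + 1, 2) ∈ A := by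
  obtain ⟨p, hp, q, hq, hpA, hqA, hpq⟩ := h.crossing (S := {z | level len z ≤ k}) hx (not_le.2 hy)
  have hp : level len p ≤ k := hp
  have hq : k < level len q := not_le.1 hq
  obtain ⟨a, b, rfl, rfl, hab⟩ := attach_adj_of_base_ne hpq fun h => by
    rw [level, h] at hp; exact absurd hp (not_le.2 hq)
  cases hab with
  | cc j =>
    obtain rfl : j = k := by simp only [level, base_inl] at hp hq; omega
    exact ⟨hpA, hqA⟩
  | _ => simp only [level, base_inl] at hp hq; omega

theorem chain_descend (h : ReachIn (chain len).Adj A x y) (hx : k < level len x)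
    (hy : level len y ≤ k) : Sum.inl (k + 1, 0) ∈ A ∧ Sum.inl (k, 0) ∈ A := by
  obtain ⟨p, hp, q, hq, hpA, hqA, hpq⟩ := h.crossing (S := {z | k < level len z}) hx (not_lt.2 hy)
  have hp : k < level len p := hp
  have hq : level len q ≤ k := not_lt.1 hq
  obtain ⟨a, b, rfl, rfl, hab⟩ := attach_adj_of_base_ne hpq fun h => by
    rw [level, ← h] at hq; exact absurd hq (not_le.2 hp)
  cases hab with
  | aa j =>
    obtain rfl : j = k := by simp only [level, base_inl] at hp hq; omega
    exact ⟨hpA, hqA⟩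
  | _ => simp only [level, base_inl] at hp hq; omega

theorem chain_exit (h : ReachIn (chain len).Adj A x y) (hx : x ∈ toothPath len i)
    (hy : y ∉ toothPath len i) : Sum.inl (i, 2) ∈ A := by
  obtain ⟨p, hp, q, hq, -, hqA, hpq⟩ := h.crossing hx hy
  obtain ⟨a, b, rfl, rfl, hab⟩ := attach_adj_of_base_ne hpq fun h => hq (h.symm.trans hp)
  have hp : a = (i, 1) := hp
  subst hp
  cases hab
  exact hqA

theorem chain_enter (h : ReachIn (chain len).Adj A x y) (hx : x ∉ toothPath len i)
    (hy : y ∈ toothPath len i) : Sum.inl (i, 0) ∈ A := by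
  obtain ⟨p, hp, q, hq, hpA, -, hpq⟩ := h.crossing (S := (toothPath len i)ᶜ) hx (not_not.2 hy)
  have hq : base _ len q = (i, 1) := not_not.1 hq
  obtain ⟨a, b, rfl, rfl, hab⟩ := attach_adj_of_base_ne hpq fun h => hp (h.trans hq)
  have hq : b = (i, 1) := hq
  subst hq
  cases hab
  exact hpA

theorem finite_setOf_level_le (n : ℕ) : {x | level len x ≤ n}.Finite :=
  (finite_base_preimage _ len mk_one_injective ((Set.finite_Iic n).prod Set.finite_univ)).subset
    fun _ h => ⟨h, trivial⟩

theorem triangleChain_adj_level {a b : ℕ × Fin 3} (h : triangleChain.Adj a b) :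
    a.1 ≤ b.1 + 1 ∧ b.1 ≤ a.1 + 1 := by
  have h : TriangleChainAdj a b := h
  cases h <;> dsimp only <;> omega

theorem chain_level_le_of_weakAdj (h : WeakAdj (chain len) x y) :
    level len y ≤ level len x + 1 := by
  rcases h with h | h <;> rcases attach_adj_cases h with h | ⟨a, b, rfl, rfl, h⟩
  · rw [level, ← h]; exact Nat.le_succ _
  · exact (triangleChain_adj_level (attach_adj_inl_iff.1 h)).2
  · rw [level, h]; exact Nat.le_succ _
  · exact (triangleChain_adj_level (attach_adj_inl_iff.1 h)).1

theorem chain_finite_weakAdj (x : ℕ × Fin 3 ⊕ (Σ i : ℕ, Fin (len i))) :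
    {y | WeakAdj (chain len) x y}.Finite :=
  (finite_setOf_level_le _).subset fun _ h => chain_level_le_of_weakAdj h

theorem lastVertex_mem_toothPath {w : W} {μ : TreeLikeModel H (chain len)}
    (h : μ.root w = lastVertex (fun i : ℕ => (i, (1 : Fin 3))) len i) :
    μ.root w ∈ toothPath len i := by
  rw [h]; exact base_lastVertex _ len i

/-- An infinite in-arborescence of `r` comes down from arbitrarily high levels and contains `a i`
for a tooth `i` beyond the root of `r`. Walks from `r` to that tooth also need `a i`, which would
then be the root. For out-degrees, `c i` plays this role. -/
theorem chain_finite_degrees (μ : TreeLikeModel H (chain len)) (hH : StronglyConnected H)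
    (h : (Set.range (lastVertex (fun i : ℕ => (i, (1 : Fin 3))) len) ∩
      Set.range μ.root).Infinite) (r : W) :
    {z | H.Adj z r}.Finite ∧ {z | H.Adj r z}.Finite := by
  obtain ⟨i, ⟨x, hx⟩, hi⟩ :=
    (infinite_setOf_root_eq_lastVertex μ h).exists_gt (level len (μ.root r))
  have hxP := lastVertex_mem_toothPath hx
  have hrP : μ.root r ∉ toothPath len i := fun h => hi.ne (level_of_mem_toothPath h)
  constructor <;> refine Set.not_infinite.1 fun hr => ?_
  · obtain ⟨p, hp, hpi⟩ := (μ.inTree_infinite (fun p => (chain_finite_weakAdj p).subset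
      fun _ h => Or.inr h) hr).exists_notMem_finite (finite_setOf_level_le i)
    have hin := (chain_descend (μ.reachIn_in hp) (not_le.1 hpi) hi.le).2
    have hout := chain_enter (μ.reachIn_outSide (reachIn_univ (hH r x))) hrP hxP
    rw [← μ.eq_root hin (μ.mem_out_of_mem_outSide hout (Or.inl hin))] at hi
    exact lt_irrefl _ hi
  · obtain ⟨p, hp, hpi⟩ := (μ.outTree_infinite (fun p => (chain_finite_weakAdj p).subset
      fun _ h => Or.inl h) hr).exists_notMem_finite (finite_setOf_level_le i)
    have hout := (chain_ascend (μ.reachIn_out hp) hi.le (not_le.1 hpi)).1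
    have hin := chain_exit (μ.reachIn_inSide (reachIn_univ (hH x r))) hxP hrP
    rw [← μ.eq_root (μ.mem_in_of_mem_inSide hin (Or.inr hout)) hout] at hi
    exact lt_irrefl _ hi

/-- Both walks pass through `c i` if `ρ` is not beyond level `i`, and through the vertex `c` at the
level of `ρ` otherwise; so this vertex is `ρ`. In `chain_through_left` the same holds with row `a`.
-/
theorem chain_through_right {α β : Set (ℕ × Fin 3 ⊕ (Σ i : ℕ, Fin (len i)))}
    {ρ : ℕ × Fin 3 ⊕ (Σ i : ℕ, Fin (len i))} (hαβ : ∀ z ∈ α, z ∈ β → z = ρ)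
    (hx : x ∈ toothPath len i) (hρ : ρ ∉ toothPath len i) (hi : i < level len y)
    (hρy : level len ρ < level len y) (hα : ReachIn (chain len).Adj α x ρ)
    (hβ : ReachIn (chain len).Adj β ρ y) : ∃ l, ρ = Sum.inl (l, 2) := by
  rcases le_or_gt (level len ρ) i with h | h
  · exact ⟨i, (hαβ _ (chain_exit hα hx hρ) (chain_ascend hβ h hi).1).symm⟩
  · obtain ⟨k, hk⟩ := Nat.exists_eq_add_one_of_ne_zero (Nat.ne_of_gt (Nat.zero_lt_of_lt h))
    refine ⟨level len ρ, (hαβ _ ?_ (chain_ascend hβ le_rfl hρy).1).symm⟩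
    have := (chain_ascend (k := k) hα (by rw [level_of_mem_toothPath hx]; omega) (by omega)).2
    rwa [← hk] at this

theorem chain_through_left {α β : Set (ℕ × Fin 3 ⊕ (Σ i : ℕ, Fin (len i)))}
    {ρ : ℕ × Fin 3 ⊕ (Σ i : ℕ, Fin (len i))} (hαβ : ∀ z ∈ α, z ∈ β → z = ρ)
    (hx : x ∈ toothPath len i) (hρ : ρ ∉ toothPath len i) (hi : i < level len y)
    (hρy : level len ρ < level len y) (hα : ReachIn (chain len).Adj α y ρ)
    (hβ : ReachIn (chain len).Adj β ρ x) : ∃ l, ρ = Sum.inl (l, 0) := by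
  rcases le_or_gt (level len ρ) i with h | h
  · exact ⟨i, (hαβ _ (chain_descend hα hi h).2 (chain_enter hβ hρ hx)).symm⟩
  · obtain ⟨k, hk⟩ := Nat.exists_eq_add_one_of_ne_zero (Nat.ne_of_gt (Nat.zero_lt_of_lt h))
    refine ⟨level len ρ, (hαβ _ (chain_descend hα hρy le_rfl).2 ?_).symm⟩
    have := (chain_descend (k := k) hβ (by omega) (by rw [level_of_mem_toothPath hx]; omega)).1
    rwa [← hk] at this

/-- A walk can leave `S` only from `m`, so it may be stopped there before leaving. -/
theorem reachIn_cut {W : Type v} {R : W → W → Prop} {S : Set W} {m u : W}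
    (hS : ∀ x ∈ S, ∀ y ∉ S, R x y → x = m) (hu : u ∈ S) (h : ReflTransGen R u m) :
    ReachIn R S u m := by
  induction h using ReflTransGen.head_induction_on with
  | refl => exact .refl _ _ _
  | @head a c h _ ih =>
    by_cases hc : c ∈ S
    · exact (ReachIn.single h hu hc).trans (ih hc)
    · obtain rfl := hS a hu c hc h
      exact .refl _ _ _

theorem reachIn_cut_compl {W : Type v} {R : W → W → Prop} {S : Set W} {m u : W}
    (hS : ∀ x ∈ S, ∀ y ∉ S, R y x → x = m) (hu : u ∉ S) (h : ReflTransGen R u m) :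
    ReachIn R (Sᶜ ∪ {m}) u m := by
  induction h using ReflTransGen.head_induction_on with
  | refl => exact .refl _ _ _
  | @head a c h _ ih =>
    by_cases hc : c ∈ S
    · obtain rfl := hS c hc a hu h
      exact ReachIn.single h (Or.inl hu) (Or.inr rfl)
    · exact (ReachIn.single h (Or.inl hu) (Or.inl hc)).trans (ih hc)

/-- A cut vertex `m` of the minor separates a tooth `x` in `S` from a far tooth `y` outside. Walks
between them in either direction are split at `m` into lifts meeting only in its root. Going right
puts this root on row `c`, going left on row `a`. -/
theorem chain_not_cutVertexExhausted (μ : TreeLikeModel H (chain len)) (hH : StronglyConnected H)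
    (h : (Set.range (lastVertex (fun i : ℕ => (i, (1 : Fin 3))) len) ∩
      Set.range μ.root).Infinite) : ¬ CutVertexExhausted H := by
  intro hcut
  have hinf := infinite_setOf_root_eq_lastVertex μ h
  obtain ⟨i, ⟨x, hx⟩⟩ := hinf.nonempty
  obtain ⟨i', ⟨x', hx'⟩, hii'⟩ := hinf.exists_gt i
  obtain ⟨S, hS, hxS, m, hm, hmx, hSm⟩ := hcut {x, x'} ((Set.finite_singleton _).insert _)
  -- Two teeth are placed in `S` because the root of `m` may lie on one of their tooth paths, but
  -- not on both.
  have hpath : ∃ i x, μ.root x ∈ toothPath len i ∧ x ∈ S ∧ μ.root m ∉ toothPath len i := by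
    by_cases hmi : μ.root m ∈ toothPath len i
    · refine ⟨i', x', lastVertex_mem_toothPath hx', hxS (by simp), fun h => hii'.ne ?_⟩
      rw [← level_of_mem_toothPath hmi, level_of_mem_toothPath h]
    · exact ⟨i, x, lastVertex_mem_toothPath hx, hxS (by simp), hmi⟩
  clear! x x' i i'
  obtain ⟨i, x, hx, hxS, hmP⟩ := hpath
  have hfin : {j | ∃ w ∈ S, level len (μ.root w) = j}.Finite :=
    hS.image fun w => level len (μ.root w)
  obtain ⟨j, ⟨y, hy⟩, hj⟩ := hinf.exists_notMem_finite
    (hfin.union (Set.finite_Iic (max i (level len (μ.root m)))))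
  rw [Set.mem_union, not_or, Set.mem_Iic, not_le, max_lt_iff] at hj
  obtain ⟨hyS, hij, hmj⟩ := hj
  have hyj := level_of_mem_toothPath (lastVertex_mem_toothPath hy)
  replace hyS : y ∉ S := fun h => hyS ⟨y, h, hyj⟩
  rw [← hyj] at hij hmj
  have hZ : S ∩ (Sᶜ ∪ {m}) ⊆ {m} := by
    rintro z ⟨hz, hz' | hz'⟩
    exacts [absurd hz hz', hz']
  obtain ⟨l, hl⟩ := chain_through_right
    (fun z hz hz' => μ.eq_root_of_mem_sides hz hz' hZ) hx hmP hij hmj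
    (μ.reachIn_inSide (reachIn_cut (fun x hx y hy h => hSm x hx y hy (Or.inl h)) hxS (hH x m)))
    (μ.reachIn_outSide (reachIn_cut_compl (fun x hx y hy h => hSm x hx y hy (Or.inl h)) hyS
      (reflTransGen_swap (hH m y))).swap)
  obtain ⟨l', hl'⟩ := chain_through_left
    (fun z hz hz' => μ.eq_root_of_mem_sides hz hz' ((Set.inter_comm _ _).trans_subset hZ))
    hx hmP hij hmj
    (μ.reachIn_inSide (reachIn_cut_compl (fun x hx y hy h => hSm x hx y hy (Or.inr h)) hyS
      (hH y m)))
    (μ.reachIn_outSide (reachIn_cut (fun x hx y hy h => hSm x hx y hy (Or.inr h)) hxS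
      (reflTransGen_swap (hH m x))).swap)
  rw [hl] at hl'
  exact absurd (congrArg Prod.snd (Sum.inl_injective hl')) (by simp)

end Chain

/-! ### Comparison of the types -/

/-- Properties of the digraphs of a type that are used for showing that they are not minors of
digraphs of other types. -/
def Profile {V : Type u} (D : Digraph V) : OutcomeType → Prop
  | .vertexStar => HasInfiniteStar D
  | .rayStar => HasDominatedRay D ∧ HasDisjointDigons D
  | .dominatedRay => HasDominatedRay D ∧ WeaklyTwoConnected D
  | .comb => HasStrongRay D ∧ CutVertexExhausted D ∧ ¬ HasTriangle D
  | .triangleComb => HasStrongRay D ∧ CutVertexExhausted D ∧ HasTriangle D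
  | .triangleChain => HasStrongRay D ∧ HasTriangle D ∧ ¬ HasCyclicTrisection D

theorem single_stronglyConnected : StronglyConnected single := fun _ _ => .refl

theorem dominatedRay_stronglyConnected {K : Digraph ℕ}
    (hK : K = dominatedOutRay ∨ K = dominatedInRay) : StronglyConnected K := by
  rcases hK with rfl | rfl
  exacts [dominatedOutRay_stronglyConnected, dominatedInRay_stronglyConnected]

theorem dominatedRay_hasDominatedRay {K : Digraph ℕ}
    (hK : K = dominatedOutRay ∨ K = dominatedInRay) : HasDominatedRay K := by
  refine ⟨0, Nat.succ, Nat.succ_injective, Nat.succ_ne_zero,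
    fun i => (weakAdj_dominatedRay hK (i + 1)).1, ?_⟩
  rcases hK with rfl | rfl
  · exact Or.inl (infinite_setOf_ne_zero_prop fun n hn => Or.inr ⟨hn, rfl⟩)
  · exact Or.inr (infinite_setOf_ne_zero_prop fun n hn => Or.inr ⟨hn, rfl⟩)

theorem attach_hasDominatedRay {B I : Type u} {K : Digraph B} {β : I → B} {len : I → ℕ}
    (hK : HasDominatedRay K) : HasDominatedRay (attach K β len) := by
  obtain ⟨r, v, hv, hvr, hadj, hr⟩ := hK
  refine ⟨Sum.inl r, fun i => Sum.inl (v i), fun i j h => hv (Sum.inl_injective h),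
    fun i h => hvr i (Sum.inl_injective h), fun i => (hadj i).imp .core .core,
    hr.imp (fun hr => ?_) (fun hr => ?_)⟩ <;>
  · refine (hr.image Sum.inl_injective.injOn).mono ?_
    rintro _ ⟨z, hz, rfl⟩
    exact .core hz

theorem profile_vertexStar {I : Type u} [Infinite I] {len : I → ℕ} (hlen : ∀ i, 0 < len i) :
    Profile (attach single.{u} (fun _ : I => PUnit.unit) len) .vertexStar := by
  have hinj : Function.Injective fun i : I =>
      (Sum.inr ⟨i, ⟨0, hlen i⟩⟩ : PUnit.{u + 1} ⊕ (Σ i : I, Fin (len i))) :=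
    fun i j h => congrArg Sigma.fst (Sum.inr_injective h)
  refine ⟨Sum.inl PUnit.unit, (Set.infinite_range_of_injective hinj).mono ?_,
    (Set.infinite_range_of_injective hinj).mono ?_⟩
  · rintro _ ⟨i, rfl⟩; exact .firstIn i (hlen i)
  · rintro _ ⟨i, rfl⟩; exact .firstOut i (hlen i)

theorem profile_rayStar {K : Digraph ℕ} (hK : K = dominatedOutRay ∨ K = dominatedInRay)
    {len : ℕ → ℕ} (hlen : ∀ n, 0 < len n) : Profile (attach K id len) .rayStar :=
  ⟨attach_hasDominatedRay (dominatedRay_hasDominatedRay hK),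
    Sum.inl 0, Sum.inr ⟨0, ⟨0, hlen 0⟩⟩, Sum.inl 1, Sum.inr ⟨1, ⟨0, hlen 1⟩⟩,
    Sum.inl_ne_inr, Sum.inl_ne_inr, by simp, .firstOut 0 _, .firstIn 0 _, .firstOut 1 _,
    .firstIn 1 _⟩

theorem profile_dominatedRay {K : Digraph ℕ} (hK : K = dominatedOutRay ∨ K = dominatedInRay) :
    Profile K .dominatedRay :=
  ⟨dominatedRay_hasDominatedRay hK, dominatedRay_weaklyTwoConnected hK⟩

theorem profile_comb {J : Set ℕ} (len : J → ℕ) :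
    Profile (attach doubleRay (fun j : J => (j : ℕ)) len) .comb :=
  ⟨attach_hasStrongRay doubleRay_hasStrongRay,
    attach_cutVertexExhausted Subtype.val_injective doubleRay_cutVertexExhausted,
    comb_not_hasTriangle len⟩

theorem profile_triangleComb {J : Set ℕ} [DecidablePred (· ∈ J)] (hJ : J.Infinite) (o : ℕ → Bool)
    (len : J → ℕ) :
    Profile (attach (triangleRay J o) (fun j : J => toothEnd J j) len) .triangleComb :=
  ⟨attach_hasStrongRay triangleRay_hasStrongRay,
    attach_cutVertexExhausted toothEnd_injective triangleRay_cutVertexExhausted,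
    attach_hasTriangle (triangleRay_hasTriangle hJ)⟩

theorem profile_triangleChain (len : ℕ → ℕ) : Profile (chain len) .triangleChain :=
  ⟨attach_hasStrongRay triangleChain_hasStrongRay, attach_hasTriangle triangleChain_hasTriangle,
    fun ⟨_, _, h, ht⟩ => triangleChain_not_isTrisection len h ht⟩

theorem HasDisjointDigons.rev {V : Type u} {D : Digraph V} (h : HasDisjointDigons D) :
    HasDisjointDigons (rev D) := by
  obtain ⟨x, y, x', y', hne, hne', hdisj, hxy, hyx, hxy', hyx'⟩ := h
  exact ⟨x, y, x', y', hne, hne', hdisj, hyx, hxy, hyx', hxy'⟩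

section Hosts

variable {W : Type v} {H : Digraph W}

theorem Profile.hasWeakRay {s : OutcomeType} (h : Profile H s) (hs : s ≠ .vertexStar) :
    HasWeakRay H := by
  cases s with
  | vertexStar => exact absurd rfl hs
  | rayStar => exact h.1.hasWeakRay
  | dominatedRay => exact h.1.hasWeakRay
  | comb => exact h.1.weak
  | triangleComb => exact h.1.weak
  | triangleChain => exact h.1.weak

theorem attach_dominatedRay_excludes {K : Digraph ℕ}
    (hK : K = dominatedOutRay ∨ K = dominatedInRay) {len : ℕ → ℕ}
    (μ : TreeLikeModel H (attach K id len)) (hH : StronglyConnected H) :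
    ¬ HasInfiniteStar H ∧ ¬ HasStrongRay H := by
  rcases hK with rfl | rfl
  · exact ⟨fun ⟨c, _, hc⟩ => not_infinite_out_of_rayStar μ hH c hc, not_hasStrongRay_of_rayStar μ⟩
  -- Reversal turns the in-ray into the out-ray and exchanges in- and out-degrees; an infinite star
  -- needs both to be infinite, so either bound suffices.
  · have ν := μ.reverse
    rw [rev_attach, rev_dominatedInRay] at ν
    exact ⟨fun ⟨c, hc, _⟩ => not_infinite_out_of_rayStar ν (stronglyConnected_rev hH) c hc,
      fun h => not_hasStrongRay_of_rayStar ν h.rev⟩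

theorem dominatedRay_excludes {K : Digraph ℕ} (hK : K = dominatedOutRay ∨ K = dominatedInRay)
    (μ : TreeLikeModel H K) : ¬ HasDisjointDigons H := by
  rcases hK with rfl | rfl
  · exact not_hasDisjointDigons_of_dominatedOutRay μ
  · exact fun h => not_hasDisjointDigons_of_dominatedOutRay (H := rev H) μ.reverse h.rev

/-- Attaching trivial double paths does not change a digraph. -/
def attachZero {B I : Type u} (K : Digraph B) (β : I → B) :
    (attach K β fun _ => 0).Adj ≃r K.Adj where
  toFun := base β fun _ => 0
  invFun := Sum.inl
  left_inv := by
    rintro (b | ⟨i, k⟩)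
    · rfl
    · exact k.elim0
  right_inv _ := rfl
  map_rel_iff' := by
    rintro (a | ⟨i, k⟩) (b | ⟨j, l⟩)
    · exact attach_adj_inl_iff.symm
    · exact l.elim0
    · exact k.elim0
    · exact k.elim0

/-- The presence of teeth enters for three hosts: a single tooth rules out dominated rays in a ray
star, and infinitely many supply the trisection of a triangle comb and the separated teeth of a
chain. -/
theorem eq_of_profile {V : Type u} {D : Digraph V} {T : Set V} {t : OutcomeType}
    (hD : HasType t D T) (μ : TreeLikeModel H D) (hH : StronglyConnected H)
    (hT : (T ∩ Set.range μ.root).Infinite) {s : OutcomeType} (hs : Profile H s) : s = t := by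
  cases t with
  | vertexStar =>
    obtain ⟨I, len, _, hlen, φ, rfl⟩ := hD
    by_contra hne
    exact not_hasWeakRay_of_vertexStar (μ.mapHost φ) (hs.hasWeakRay hne)
  | rayStar =>
    obtain ⟨K, hK, len, hlen, φ, rfl⟩ := hD
    obtain ⟨hstar, hray⟩ := attach_dominatedRay_excludes hK (μ.mapHost φ) hH
    cases s with
    | vertexStar => exact absurd hs hstar
    | rayStar => rfl
    | dominatedRay =>
      obtain ⟨_, ⟨i, rfl⟩, x, hx⟩ := (μ.teeth_mapHost φ _ hT).nonempty
      exact absurd hs.2 (not_weaklyTwoConnected_of_root_mem_pendant (μ.mapHost φ) hH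
        (hx ▸ lastVertex_mem_pendant id len (hlen i)))
    | comb => exact absurd hs.1 hray
    | triangleComb => exact absurd hs.1 hray
    | triangleChain => exact absurd hs.1 hray
  | dominatedRay =>
    obtain ⟨K, hK, φ⟩ : ∃ K, (K = dominatedOutRay ∨ K = dominatedInRay) ∧
        Nonempty (K.Adj ≃r D.Adj) := by
      rcases hD with ⟨φ, -⟩ | ⟨φ, -⟩
      exacts [⟨_, Or.inl rfl, ⟨φ⟩⟩, ⟨_, Or.inr rfl, ⟨φ⟩⟩]
    obtain ⟨φ⟩ := φ
    -- A dominated ray is treated as a ray with trivial pendant paths, so that the exclusions for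
    -- ray stars apply.
    obtain ⟨hstar, hray⟩ := attach_dominatedRay_excludes hK
      ((μ.mapHost φ).mapHost (attachZero K id)) hH
    cases s with
    | vertexStar => exact absurd hs hstar
    | rayStar => exact absurd hs.2 (dominatedRay_excludes hK (μ.mapHost φ))
    | dominatedRay => rfl
    | comb => exact absurd hs.1 hray
    | triangleComb => exact absurd hs.1 hray
    | triangleChain => exact absurd hs.1 hray
  | comb =>
    obtain ⟨J, len, _, φ, rfl⟩ := hD
    have hcut := (profile_comb len).2.1
    have htri := (comb_allBridges len).not_hasTriangle (μ.mapHost φ)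
    cases s with
    | vertexStar => exact absurd hs (hcut.not_hasInfiniteStar (μ.mapHost φ))
    | rayStar => exact absurd hs.1 (hcut.not_hasDominatedRay (μ.mapHost φ))
    | dominatedRay => exact absurd hs.1 (hcut.not_hasDominatedRay (μ.mapHost φ))
    | comb => rfl
    | triangleComb => exact absurd hs.2.2 htri
    | triangleChain => exact absurd hs.2.1 htri
  | triangleComb =>
    classical
    obtain ⟨J, len, o, hJ, φ, rfl⟩ := hD
    have hcut := (profile_triangleComb hJ o len).2.1
    have hsec := hasCyclicTrisection_of_triangleComb (μ.mapHost φ) hH (μ.teeth_mapHost φ _ hT)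
    cases s with
    | vertexStar => exact absurd hs (hcut.not_hasInfiniteStar (μ.mapHost φ))
    | rayStar => exact absurd hs.1 (hcut.not_hasDominatedRay (μ.mapHost φ))
    | dominatedRay => exact absurd hs.1 (hcut.not_hasDominatedRay (μ.mapHost φ))
    | comb => exact absurd hsec.hasTriangle hs.2.2
    | triangleComb => rfl
    | triangleChain => exact absurd hsec hs.2.2
  | triangleChain =>
    obtain ⟨len, φ, rfl⟩ := hD
    have hdeg := chain_finite_degrees (μ.mapHost φ) hH (μ.teeth_mapHost φ _ hT)
    have hcut := chain_not_cutVertexExhausted (μ.mapHost φ) hH (μ.teeth_mapHost φ _ hT)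
    have hray : ¬ HasDominatedRay H := by
      rintro ⟨r, -, -, -, -, hr | hr⟩
      exacts [hr (hdeg r).1, hr (hdeg r).2]
    cases s with
    | vertexStar =>
      obtain ⟨c, hc, -⟩ := hs
      exact absurd (hdeg c).1 hc
    | rayStar => exact absurd hs.1 hray
    | dominatedRay => exact absurd hs.1 hray
    | comb => exact absurd hs.2.1 hcut
    | triangleComb => exact absurd hs.2.1 hcut
    | triangleChain => rfl

/-- The model is moved to the standard copy of the minor, so no profile has to be shown invariant
under isomorphism. -/
theorem eq_of_hasType {V : Type u} {D : Digraph V} {T : Set V} {t : OutcomeType}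
    (hD : HasType t D T) (μ : TreeLikeModel H D)
    (hT : (T ∩ Set.range μ.root).Infinite) {s : OutcomeType} {T' : Set W}
    (hs : HasType s H T') : s = t := by
  have key : ∀ {B : Type v} {K : Digraph B} (_ : K.Adj ≃r H.Adj), StronglyConnected K →
      Profile K s → s = t := fun φ hK hp =>
    eq_of_profile hD (μ.mapGuest φ) hK (by rwa [μ.range_root_mapGuest φ]) hp
  -- The standard copies other than the star have their vertices in `Type`, so a second universe
  -- instance is needed.
  have key' : ∀ {B : Type} {K : Digraph B} (_ : K.Adj ≃r H.Adj), StronglyConnected K →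
      Profile K s → s = t := fun φ hK hp =>
    eq_of_profile hD (μ.mapGuest φ) hK (by rwa [μ.range_root_mapGuest φ]) hp
  cases s with
  | vertexStar =>
    obtain ⟨I, len, _, hlen, φ, -⟩ := hs
    exact key φ (attach_stronglyConnected single_stronglyConnected) (profile_vertexStar hlen)
  | rayStar =>
    obtain ⟨K, hK, len, hlen, φ, -⟩ := hs
    exact key' φ (attach_stronglyConnected (dominatedRay_stronglyConnected hK))
      (profile_rayStar hK hlen)
  | dominatedRay =>
    rcases hs with ⟨φ, -⟩ | ⟨φ, -⟩
    · exact key' φ dominatedOutRay_stronglyConnected (profile_dominatedRay (Or.inl rfl))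
    · exact key' φ dominatedInRay_stronglyConnected (profile_dominatedRay (Or.inr rfl))
  | comb =>
    obtain ⟨J, len, _, φ, -⟩ := hs
    exact key' φ (attach_stronglyConnected doubleRay_stronglyConnected) (profile_comb len)
  | triangleComb =>
    classical
    obtain ⟨J, len, o, hJ, φ, -⟩ := hs
    exact key' φ (attach_stronglyConnected triangleRay_stronglyConnected)
      (profile_triangleComb hJ o len)
  | triangleChain =>
    obtain ⟨len, φ, -⟩ := hs
    exact key' φ (attach_stronglyConnected triangleChain_stronglyConnected)
      (profile_triangleChain len)

end Hosts

/-! ### Strong connectedness, infinitely many teeth, and examples of all types -/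

theorem IsCopy.stronglyConnected_and_infinite {V : Type u} {B : Type v} {D : Digraph V} {T : Set V}
    {K : Digraph B} {S : Set B} (h : IsCopy D T K S) (hK : StronglyConnected K)
    (hS : S.Infinite) : StronglyConnected D ∧ T.Infinite := by
  obtain ⟨φ, rfl⟩ := h
  refine ⟨fun x y => ?_, hS.image φ.injective.injOn⟩
  have := reflTransGen_map φ (fun a b h => φ.map_rel_iff.2 h) (hK (φ.symm x) (φ.symm y))
  simpa using this

theorem HasType.stronglyConnected_and_infinite {V : Type u} {D : Digraph V} {T : Set V}
    {t : OutcomeType} (h : HasType t D T) : StronglyConnected D ∧ T.Infinite := by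
  cases t with
  | vertexStar =>
    obtain ⟨I, len, _, hlen, h⟩ := h
    exact h.stronglyConnected_and_infinite (attach_stronglyConnected single_stronglyConnected)
      (Set.infinite_range_of_injective (lastVertex_injective_of_pos _ len hlen))
  | rayStar =>
    obtain ⟨K, hK, len, hlen, h⟩ := h
    exact h.stronglyConnected_and_infinite
      (attach_stronglyConnected (dominatedRay_stronglyConnected hK))
      (Set.infinite_range_of_injective (lastVertex_injective _ len Function.injective_id))
  | dominatedRay =>
    rcases h with h | h
    · exact h.stronglyConnected_and_infinite dominatedOutRay_stronglyConnected Set.infinite_univ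
    · exact h.stronglyConnected_and_infinite dominatedInRay_stronglyConnected Set.infinite_univ
  | comb =>
    obtain ⟨J, len, hJ, h⟩ := h
    have := hJ.to_subtype
    exact h.stronglyConnected_and_infinite (attach_stronglyConnected doubleRay_stronglyConnected)
      (Set.infinite_range_of_injective (lastVertex_injective _ len Subtype.val_injective))
  | triangleComb =>
    classical
    obtain ⟨J, len, o, hJ, h⟩ := h
    have := hJ.to_subtype
    exact h.stronglyConnected_and_infinite (attach_stronglyConnected triangleRay_stronglyConnected)
      (Set.infinite_range_of_injective (lastVertex_injective _ len toothEnd_injective))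
  | triangleChain =>
    obtain ⟨len, h⟩ := h
    exact h.stronglyConnected_and_infinite
      (attach_stronglyConnected triangleChain_stronglyConnected)
      (Set.infinite_range_of_injective (lastVertex_injective _ len mk_one_injective))

theorem exists_hasType (t : OutcomeType) :
    ∃ (V : Type) (D : Digraph V) (T : Set V), HasType t D T := by
  cases t with
  | vertexStar =>
    exact ⟨_, _, _, ℕ, fun _ => 1, inferInstance, fun _ => Nat.one_pos, RelIso.refl _, rfl⟩
  | rayStar =>
    exact ⟨_, _, _, _, Or.inl rfl, fun _ => 1, fun _ => Nat.one_pos, RelIso.refl _, rfl⟩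
  | dominatedRay => exact ⟨_, _, _, Or.inl ⟨RelIso.refl _, rfl⟩⟩
  | comb => exact ⟨_, _, _, Set.univ, fun _ => 0, Set.infinite_univ, RelIso.refl _, rfl⟩
  | triangleComb =>
    exact ⟨_, _, _, Set.univ, fun _ => 0, fun _ => true, Set.infinite_univ, RelIso.refl _, rfl⟩
  | triangleChain => exact ⟨_, _, _, fun _ => 0, RelIso.refl _, rfl⟩

end DirectedStarComb

theorem mainTheorem3 :
    (∀ (t : DirectedStarComb.OutcomeType) (V : Type u) (D : Digraph V) (T : Set V),
      DirectedStarComb.HasType t D T →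
      ∀ (W : Type v) (D' : Digraph W) (μ : DirectedStarComb.TreeLikeModel D' D),
        DirectedStarComb.StronglyConnected D' →
        (T ∩ Set.range μ.root).Infinite →
        ∀ (s : DirectedStarComb.OutcomeType) (T' : Set W),
          DirectedStarComb.HasType s D' T' → s = t) ∧
    (∀ t : DirectedStarComb.OutcomeType,
      ∃ (V : Type) (D : Digraph V) (U : Set V),
        DirectedStarComb.HasType t D U ∧
        DirectedStarComb.StronglyConnected D ∧ U.Infinite ∧
        ∀ (W : Type v) (D' : Digraph W) (μ : DirectedStarComb.TreeLikeModel D' D)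
          (s : DirectedStarComb.OutcomeType) (T' : Set W),
          DirectedStarComb.HasType s D' T' → (∀ x ∈ T', μ.root x ∈ U) → s = t) := by
  refine ⟨fun t V D T hD W D' μ _ hT s T' hs => DirectedStarComb.eq_of_hasType hD μ hT hs,
    fun t => ?_⟩
  obtain ⟨V, D, U, hD⟩ := DirectedStarComb.exists_hasType t
  refine ⟨V, D, U, hD, hD.stronglyConnected_and_infinite.1, hD.stronglyConnected_and_infinite.2,
    fun W D' μ s T' hs hU => ?_⟩
  obtain ⟨-, hT'⟩ := hs.stronglyConnected_and_infinite
  -- The minor has infinitely many teeth, and `root` is injective, so their roots form an infinite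
  -- subset of `U`.
  refine DirectedStarComb.eq_of_hasType hD μ ((hT'.image μ.root_injective.injOn).mono ?_) hs
  rintro _ ⟨x, hx, rfl⟩
  exact ⟨hU x hx, x, rfl⟩
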